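/- A represented space $(X,\delta_X)$ is a set $X$ with a surjective partial map $\delta_X:\subseteq\mathbb{N}^{\mathbb{N}}\to X$; $p$ is a name of $\delta_X(p)$. It carries the final topology $\{U\subseteq X:\delta_X^{-1}(U)\text{ is open in }\mathrm{dom}(\delta_X)\}$, to which "open", "closed", "compact" and "saturated" (being an intersection of open sets) refer. A map between represented spaces is called computable (continuous) if some computable (continuous) partial function on $\mathbb{N}^{\mathbb{N}}$ maps every name of a point of the domain to a name of its image; it is a computable (continuous) embedding if it is injective and the map and its partial inverse are computable (continuous). Let $\mathbb{S}=\{0,1\}$ be Sierpiński space, where $0$ is named exactly by the zero sequence and $1$ by all other sequences. Let $\mathcal{C}(X,Y)$ be the space of continuous maps $X\to Y$ with the standard function space representation (names encode continuous realizers), and let - $\mathcal{O}(X)$ be the space of open subsets of $X$, represented via their characteristic functions in $\mathcal{C}(X,\mathbb{S})$; - $\mathcal{A}_-(X)$ be the space of closed subsets of $X$, represented via their complements in $\mathcal{O}(X)$; - $\mathcal{A}_+(X)$ be the space of closed subsets $A$ of $X$, represented via the characteristic functions of $\{U\in\mathcal{O}(X):A\cap U\neq\emptyset\}$ in $\mathcal{C}(\mathcal{O}(X),\mathbb{S})$;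 - $\mathcal{K}_-(X)$ be the space of saturated compact subsets $K$ of $X$, represented via the characteristic functions of $\{U\in\mathcal{O}(X):K\subseteq U\}$ in $\mathcal{C}(\mathcal{O}(X),\mathbb{S})$; - $X\times Y$, $X\sqcup Y$ and $Y^{\mathbb{N}}$ be the product, coproduct and countable power with their canonical representations; a subspace of $X$ be a subset with the restriction of $\delta_X$; - $X\sqcap Y$ be the meet, i.e. the set $X\cap Y$, where a name of a point is a pair of a name of it in $X$ and a name of it in $Y$; - $\mathcal{A}(X)=\mathcal{A}_+(X)\sqcap\mathcal{A}_-(X)$ and $\mathcal{K}(X)=\mathcal{A}_+(X)\sqcap\mathcal{K}_-(X)$. A represented space $X$ is a computable (continuous) Kolmogorov space if the neighborhood map $X\to\mathcal{O}(\mathcal{O}(X))$, $x\mapsto\{U\in\mathcal{O}(X):x\in U\}$, is a computable (continuous) embedding. **Corollary.** (1) If $X$ and $Y$ are computable Kolmogorov spaces, then so are $X\times Y$, $X\sqcup Y$, $X\sqcap Y$, $Y^{\mathbb{N}}$ and every subspace of $X$. (2) Let $X$ be a represented space. If $Y$ is a computable Kolmogorov space, then so is $\mathcal{C}(X,Y)$;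 moreover $\mathcal{O}(X)$, $\mathcal{A}_+(X)$, $\mathcal{A}_-(X)$, $\mathcal{A}(X)$, $\mathcal{K}_-(X)$ and $\mathcal{K}(X)$ are computable Kolmogorov spaces. (3) Statements (1) and (2) hold analogously with "continuous Kolmogorov space" in place of "computable Kolmogorov space". -/

import Mathlib

open Set Topology

universe u v

/-! ### Computable and continuous functions on Baire space -/

/-- Baire space `ℕ^ℕ`, with the product topology. -/
abbrev Baire : Type := ℕ → ℕ

/-- The code of the query `(n, (q 0, …, q (k - 1)))`. -/
def queryCode (q : Baire) (k n : ℕ) : ℕ :=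
  Encodable.encode (n, (List.range k).map q)

/-- `App a q r`: the partial continuous function on Baire space with associate `a` is defined
at `q` with value `r`. To find `r n`, `a` is asked about longer and longer prefixes of `q`;
answer `0` means that more input is needed, and the first answer `m + 1` means `r n = m`. -/
def App (a q r : Baire) : Prop :=
  ∀ n, ∃ k, a (queryCode q k n) = r n + 1 ∧ ∀ j < k, a (queryCode q j n) = 0

theorem App.unique {a q r s : Baire} (h : App a q r) (h' : App a q s) : r = s := by
  funext n
  obtain ⟨k, hk, hk'⟩ := h n
  obtain ⟨l, hl, hl'⟩ := h' n
  rcases lt_trichotomy k l with hkl | hkl | hkl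
  · have := hl' k hkl; omega
  · subst hkl; omega
  · have := hk' l hkl; omega

/-- `F` is computable on `D`: there is an algorithm which on input `n` and longer and longer
prefixes of `p ∈ D` outputs `F p n` after reading finitely much of `p`. -/
def ComputableFunOn (F : Baire → Baire) (D : Set Baire) : Prop :=
  ∃ a : Baire, Computable a ∧ ∀ p ∈ D, App a p (F p)

/-! ### Represented spaces -/

/-- A represented space whose points lie in the ambient type `α`: the graph
`Names p x ↔ δ(p) = x` of a partial map `δ : ⊆ ℕ^ℕ → α`. The underlying set of the space is the
range of `δ`, so that `δ` is surjective onto it. -/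
@[ext]
structure RepSpace (α : Type u) where
  /-- `p` is a name of `x`, that is, `δ(p) = x`. -/
  Names : Baire → α → Prop
  unique : ∀ {p x y}, Names p x → Names p y → x = y

namespace RepSpace

variable {α : Type u} {β : Type v}

/-- The underlying set of a represented space. -/
def carrier (X : RepSpace α) : Set α := {x | ∃ p, X.Names p x}

/-- The domain of the representation. -/
def dom (X : RepSpace α) : Set Baire := {p | ∃ x, X.Names p x}

/-- The type of points of a represented space. -/
def Pt (X : RepSpace α) : Type u := {x : α // x ∈ X.carrier}

/-- The representation, as a function on its domain. -/
noncomputable def rep (X : RepSpace α) (p : X.dom) : X.Pt :=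
  ⟨p.2.choose, p.1, p.2.choose_spec⟩

theorem names_rep (X : RepSpace α) (p : X.dom) : X.Names p.1 (X.rep p).1 := p.2.choose_spec

theorem rep_eq (X : RepSpace α) {p : X.dom} {x : X.Pt} (h : X.Names p.1 x.1) : X.rep p = x :=
  Subtype.ext (X.unique (X.names_rep p) h)

/-- The final topology of the representation. -/
noncomputable instance instTopologicalSpacePt (X : RepSpace α) : TopologicalSpace X.Pt :=
  TopologicalSpace.coinduced X.rep inferInstance

/-! ### Function spaces and hyperspaces -/

/-- The space `C(X, Y)` of the functions `X → Y` that have a continuous realizer. A name of `f`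
is an associate of such a realizer. -/
def fn (X : RepSpace α) (Y : RepSpace β) : RepSpace (X.Pt → β) where
  Names p f := ∀ (q : Baire) (x : X.Pt), X.Names q x.1 → ∃ r, App p q r ∧ Y.Names r (f x)
  unique := by
    intro p f g hf hg
    funext x
    obtain ⟨q, hq⟩ := x.2
    obtain ⟨r, hr, hr'⟩ := hf q x hq
    obtain ⟨s, hs, hs'⟩ := hg q x hq
    cases hr.unique hs
    exact Y.unique hr' hs'

/-- Sierpiński space: the zero sequence names `False`, all other sequences name `True`. -/
def sierpinski : RepSpace Prop where
  Names p b := b ↔ ∃ n, p n ≠ 0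
  unique h h' := propext (h.trans h'.symm)

/-- The space `O(X)` of open subsets of `X`, represented through their characteristic functions
in `C(X, 𝕊)`. -/
def opens (X : RepSpace α) : RepSpace (Set X.Pt) where
  Names p U := (fn X sierpinski).Names p (fun x => x ∈ U)
  unique h h' := (fn X sierpinski).unique h h'

/-- The points of `O(X)` are exactly the open sets of the final topology. -/
theorem mem_carrier_opens (X : RepSpace α) (U : Set X.Pt) : U ∈ X.opens.carrier ↔ IsOpen U := by
  classical
  have hmap : ∀ (q q' : Baire) (k : ℕ),
      (List.range k).map q = (List.range k).map q' ↔ ∀ i < k, q i = q' i := by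
    intro q q' k
    simp
  rw [isOpen_coinduced]
  constructor
  · rintro ⟨p, hp⟩
    rw [isOpen_iff_mem_nhds]
    intro q hq
    obtain ⟨r, hr, hr'⟩ := hp q.1 (X.rep q) (X.names_rep q)
    obtain ⟨n, hn⟩ := hr'.1 hq
    obtain ⟨k, hk, hk'⟩ := hr n
    have hopen : IsOpen {q' : X.dom | ∀ i < k, q'.1 i = q.1 i} := by
      have : {q' : X.dom | ∀ i < k, q'.1 i = q.1 i}
          = ⋂ i ∈ Set.Iio k, (fun q' : X.dom => q'.1 i) ⁻¹' {q.1 i} := by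
        ext; simp
      rw [this]
      refine (Set.finite_Iio k).isOpen_biInter fun i _ => ?_
      exact (isOpen_discrete _).preimage ((continuous_apply i).comp continuous_subtype_val)
    refine Filter.mem_of_superset (hopen.mem_nhds (fun i _ => rfl)) ?_
    intro q' hq'
    obtain ⟨s, hs, hs'⟩ := hp q'.1 (X.rep q') (X.names_rep q')
    refine hs'.2 ⟨n, ?_⟩
    obtain ⟨l, hl, hl'⟩ := hs n
    have heq : ∀ j ≤ k, queryCode q'.1 j n = queryCode q.1 j n := by
      intro j hj
      unfold queryCode
      rw [(hmap q'.1 q.1 j).2 fun i hi => hq' i (lt_of_lt_of_le hi hj)]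
    rcases lt_trichotomy l k with hlk | hlk | hlk
    · rw [heq l hlk.le, hk' l hlk] at hl; omega
    · subst hlk; rw [heq l le_rfl, hk] at hl; omega
    · have := hl' k hlk; rw [heq k le_rfl, hk] at this; omega
  · intro h
    obtain ⟨V, hV, hVU⟩ := isOpen_induced_iff.1 h
    let good : List ℕ → Prop := fun w => ∀ q : Baire, (List.range w.length).map q = w → q ∈ V
    let g : ℕ × List ℕ → ℕ := fun c =>
      if c.2.length = c.1 then (if good c.2 then 2 else 1) else 0
    refine ⟨fun m => ((Encodable.decode (α := ℕ × List ℕ) m).map g).getD 0, ?_⟩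
    intro q x hq
    refine ⟨fun n => if good ((List.range n).map q) then 1 else 0, ?_, ?_⟩
    · intro n
      refine ⟨n, ?_, ?_⟩
      · simp only [queryCode, Encodable.encodek, Option.map_some, Option.getD_some, g,
          List.length_map, List.length_range, if_true]
        split_ifs <;> rfl
      · intro j hj
        simp [queryCode, g, hj.ne]
    · have hx : x ∈ U ↔ q ∈ V := by
        rw [← X.rep_eq (p := ⟨q, x.1, hq⟩) hq]
        exact (Set.ext_iff.1 hVU ⟨q, x.1, hq⟩).symm
      change x ∈ U ↔ _
      rw [hx]
      constructor
      · intro hqV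
        obtain ⟨I, u, hu, huV⟩ := isOpen_pi_iff.1 hV q hqV
        refine ⟨I.sup id + 1, ?_⟩
        have : good ((List.range (I.sup id + 1)).map q) := by
          intro q' hq'
          rw [List.length_map, List.length_range, hmap] at hq'
          refine huV fun i hi => ?_
          rw [hq' i (Nat.lt_succ_of_le (Finset.le_sup (f := id) hi))]
          exact (hu i hi).2
        simp [this]
      · rintro ⟨n, hn⟩
        have : good ((List.range n).map q) := by
          by_contra hc
          simp [hc] at hn
        exact this q (by simp)

/-- The space `A₋(X)` of closed subsets of `X`, represented as complements of open sets. -/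
def closedNeg (X : RepSpace α) : RepSpace (Set X.Pt) where
  Names p A := X.opens.Names p Aᶜ
  unique h h' := compl_injective (X.opens.unique h h')

/-- The space `A₊(X)` of closed subsets `A` of `X`, represented through the continuous maps
`∃_A : O(X) → 𝕊`, the characteristic functions of `{U | A ∩ U ≠ ∅}`. -/
def closedPos (X : RepSpace α) : RepSpace (Set X.Pt) where
  Names p A := IsClosed A ∧
    (fn X.opens sierpinski).Names p (fun U => (A ∩ U.1).Nonempty)
  unique := by
    rintro p A B ⟨hA, hpA⟩ ⟨hB, hpB⟩
    have h := (fn X.opens sierpinski).unique hpA hpB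
    have key : ∀ C D : Set X.Pt, IsClosed D →
        (∀ U : X.opens.Pt, (C ∩ U.1).Nonempty → (D ∩ U.1).Nonempty) → C ⊆ D := by
      intro C D hD hCD x hx
      by_contra hxD
      obtain ⟨y, hy, hy'⟩ :=
        hCD ⟨Dᶜ, (X.mem_carrier_opens _).2 hD.isOpen_compl⟩ ⟨x, hx, hxD⟩
      exact hy' hy
    exact Set.Subset.antisymm
      (key A B hB fun U hU => (congrFun h U).mp hU)
      (key B A hA fun U hU => (congrFun h U).mpr hU)

/-- The space `K₋(X)` of saturated compact subsets `K` of `X`, represented through the continuous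
maps `∀_K : O(X) → 𝕊`, the characteristic functions of `{U | K ⊆ U}`. A set is saturated if it is
the intersection of all open sets that contain it. -/
def compactNeg (X : RepSpace α) : RepSpace (Set X.Pt) where
  Names p K := IsCompact K ∧ K = ⋂₀ {U | IsOpen U ∧ K ⊆ U} ∧
    (fn X.opens sierpinski).Names p (fun U => K ⊆ U.1)
  unique := by
    rintro p K L ⟨-, hK, hpK⟩ ⟨-, hL, hpL⟩
    have h := (fn X.opens sierpinski).unique hpK hpL
    rw [hK, hL]
    congr 1
    ext U
    refine and_congr_right fun hU => ?_
    exact iff_of_eq (congrFun h ⟨U, (X.mem_carrier_opens _).2 hU⟩)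

/-! ### Set-theoretic constructions -/

/-- The even part of a sequence: first component of a pair of names. -/
def fstName (r : Baire) : Baire := fun n => r (2 * n)

/-- The odd part of a sequence: second component of a pair of names. -/
def sndName (r : Baire) : Baire := fun n => r (2 * n + 1)

/-- The product `X × Y`. -/
def prod (X : RepSpace α) (Y : RepSpace β) : RepSpace (α × β) where
  Names r z := X.Names (fstName r) z.1 ∧ Y.Names (sndName r) z.2
  unique h h' := Prod.ext (X.unique h.1 h'.1) (Y.unique h.2 h'.2)

/-- The coproduct `X ⊔ Y`: a name starts with `0` or `1`, which tells the summand, and continues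
with a name of the point in this summand. -/
def coprod (X : RepSpace α) (Y : RepSpace β) : RepSpace (α ⊕ β) where
  Names r z := Sum.elim
    (fun x => r 0 = 0 ∧ X.Names (fun n => r (n + 1)) x)
    (fun y => r 0 = 1 ∧ Y.Names (fun n => r (n + 1)) y) z
  unique := by
    rintro r (x | x) (y | y) ⟨h0, h⟩ ⟨h0', h'⟩
    · exact congrArg Sum.inl (X.unique h h')
    · omega
    · omega
    · exact congrArg Sum.inr (Y.unique h h')

/-- The meet `X ⊓ Y`, with underlying set `X ∩ Y`: a name is a pair of a name of the point in `X`
and a name of the same point in `Y`. -/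
def meet (X Y : RepSpace α) : RepSpace α where
  Names r x := X.Names (fstName r) x ∧ Y.Names (sndName r) x
  unique h h' := X.unique h.1 h'.1

/-- The countable power `Y^ℕ`: a name encodes a sequence of names of the components. -/
def seqPow (Y : RepSpace β) : RepSpace (ℕ → β) where
  Names r s := ∀ n, Y.Names (fun k => r (Nat.pair n k)) (s n)
  unique h h' := funext fun n => Y.unique (h n) (h' n)

/-- The subspace `Z` of `X`, with the restricted representation. -/
def subspace (X : RepSpace α) (Z : Set α) : RepSpace α where
  Names p x := X.Names p x ∧ x ∈ Z
  unique h h' := X.unique h.1 h'.1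

/-- The space `A(X) = A₊(X) ⊓ A₋(X)` of closed subsets of `X`. -/
def closeds (X : RepSpace α) : RepSpace (Set X.Pt) := meet X.closedPos X.closedNeg

/-- The space `K(X) = A₊(X) ⊓ K₋(X)` of closed saturated compact subsets of `X`. -/
def compacts (X : RepSpace α) : RepSpace (Set X.Pt) := meet X.closedPos X.compactNeg

/-! ### Kolmogorov spaces -/

/-- `f` is an embedding of `X` into `Y` with respect to a notion `P` of effectivity of functions on
Baire space: `f` is injective, it maps into `Y` and has a realizer with property `P`, and its
partial inverse has a realizer with property `P`. -/
def IsEmbeddingWrt (P : (Baire → Baire) → Set Baire → Prop) (X : RepSpace α) (Y : RepSpace β)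
    (f : X.Pt → β) : Prop :=
  Function.Injective f ∧
  (∃ F, P F X.dom ∧ ∀ p (x : X.Pt), X.Names p x.1 → Y.Names (F p) (f x)) ∧
  (∃ G, P G {p | ∃ x : X.Pt, Y.Names p (f x)} ∧
    ∀ p (x : X.Pt), Y.Names p (f x) → X.Names (G p) x.1)

/-- The neighborhood map `X → O(O(X))`, `x ↦ {U ∈ O(X) | x ∈ U}`. -/
def nbhdMap (X : RepSpace α) (x : X.Pt) : Set X.opens.Pt := {U | x ∈ U.1}

/-- `X` is a computable Kolmogorov space: its neighborhood map is a computable embedding. -/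
def IsComputableKolmogorov (X : RepSpace α) : Prop :=
  IsEmbeddingWrt ComputableFunOn X X.opens.opens X.nbhdMap

/-- `X` is a continuous Kolmogorov space: its neighborhood map is a continuous embedding. -/
def IsContinuousKolmogorov (X : RepSpace α) : Prop :=
  IsEmbeddingWrt (fun F D => ContinuousOn F D) X X.opens.opens X.nbhdMap

end RepSpace

/-! The neighborhood map is always effective, being the curried evaluation `(x, U) ↦ x ∈ U`. So a
space is Kolmogorov as soon as a name of a point can be computed from a name of its neighborhood
filter; injectivity is then automatic (`isKolmogorov_iff`).

A name of the filter of `z` semidecides every property `R q z` that can be semidecided from `q` and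
a name of `z`: currying turns `q` into a name of the open set `{z | R q z}`, and the filter name is
applied to it (`exists_observe`). Now let `Y` be Kolmogorov and `f q z` a point of `Y` depending
effectively on `q` and a name of `z`. For open `V`, the property `f q z ∈ V` is of this kind, so a
filter name of `z` yields a filter name of `f q z`, and hence a name of `f q z` itself
(`exists_recover`). Projections, inclusions and evaluations in the role of `f` settle products,
meets, subspaces, powers and function spaces. Spaces represented by maps into Sierpiński space need
only `exists_observe`, and `closeds` and `compacts` are meets of such spaces. In a coproduct both
summands are open, so a parallel search in the filter finds the right one, where the point is then
recovered.

Both versions are proved at once through `EffOn c`, whose associate must be computable only if `c`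
holds; `c = False` gives continuity by `effOn_false_iff`. The closure properties of `EffOn` rest on
`Approximates`: finite approximations compose more easily than associates, whose answers matter only
up to the first nonzero one. -/

/-! ### Finite prefixes -/

namespace Baire

/-- The prefix of length `k` of `p`. -/
def pre (p : Baire) (k : ℕ) : List ℕ := (List.range k).map p

@[simp] theorem length_pre (p : Baire) (k : ℕ) : (pre p k).length = k := by simp [pre]

theorem pre_succ (p : Baire) (k : ℕ) : pre p (k + 1) = pre p k ++ [p k] := by
  simp [pre, List.range_succ]

theorem take_pre (p : Baire) {j k : ℕ} (h : j ≤ k) : (pre p k).take j = pre p j := by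
  simp [pre, ← List.map_take, List.take_range, h]

theorem getElem?_pre (p : Baire) (k i : ℕ) : (pre p k)[i]? = if i < k then some (p i) else none := by
  split_ifs with h <;> simp [pre, h]

theorem pre_eq_pre {p q : Baire} {k : ℕ} : pre p k = pre q k ↔ ∀ i < k, p i = q i := by
  simp [pre]

theorem queryCode_eq (q : Baire) (k n : ℕ) : queryCode q k n = Encodable.encode (n, pre q k) := rfl

/-! ### Bounded search -/

/-- The least `j < k` with `P j = false`, or `k` if there is none. -/
def climb (P : ℕ → Bool) : ℕ → ℕ
  | 0 => 0
  | k + 1 => cond (P (climb P k)) (climb P k + 1) (climb P k)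

theorem climb_le (P : ℕ → Bool) (k : ℕ) : climb P k ≤ k := by
  induction k with
  | zero => rfl
  | succ k ih => rw [climb]; cases P (climb P k) <;> simp <;> omega

theorem of_lt_climb (P : ℕ → Bool) (k : ℕ) : ∀ j < climb P k, P j = true := by
  induction k with
  | zero => simp [climb]
  | succ k ih =>
    intro j
    rw [climb]
    cases h : P (climb P k) with
    | false => exact ih j
    | true =>
      intro hj
      rcases Nat.lt_succ_iff_lt_or_eq.1 hj with hj | rfl
      · exact ih j hj
      · exact h

theorem climb_eq_or (P : ℕ → Bool) (k : ℕ) : climb P k = k ∨ P (climb P k) = false := by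
  induction k with
  | zero => exact Or.inl rfl
  | succ k ih =>
    rw [climb]
    cases h : P (climb P k) with
    | false => exact Or.inr h
    | true => left; rcases ih with ih | ih <;> simp_all

theorem climb_eq {P : ℕ → Bool} {j k : ℕ} (hj : P j = false) (hlt : ∀ i < j, P i = true)
    (hk : j ≤ k) : climb P k = j := by
  rcases lt_trichotomy (climb P k) j with h | h | h
  · rcases climb_eq_or P k with h' | h'
    · omega
    · simp [hlt _ h] at h'
  · exact h
  · simp [of_lt_climb P k j h] at hj

theorem computable_climb {α : Type*} [Primcodable α] {P : α → ℕ → Bool} {k : α → ℕ}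
    (hP : Computable₂ P) (hk : Computable k) : Computable fun a => climb (P a) (k a) := by
  have h : Computable₂ fun (a : α) (x : ℕ × ℕ) => cond (P a x.2) (x.2 + 1) x.2 :=
    Computable.cond (hP.comp Computable.fst (Computable.snd.comp Computable.snd))
      (Computable.succ.comp (Computable.snd.comp Computable.snd))
      (Computable.snd.comp Computable.snd)
  refine (Computable.nat_rec hk (Computable.const 0) h).of_eq fun a => ?_
  induction k a with
  | zero => rfl
  | succ n ih => simp only [climb, ← ih]

theorem computable_beq_zero : Computable fun n : ℕ => n == 0 :=
  (Primrec.beq.comp Primrec.id (Primrec.const 0)).to_comp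

/-! ### Effective functions on Baire space -/

/-- `F` has, on `D`, a realizer with an associate, which is computable if `c` holds. For `c = True`
these are the computable functions, for `c = False` the continuous ones. -/
def EffOn (c : Prop) (F : Baire → Baire) (D : Set Baire) : Prop :=
  ∃ a : Baire, (c → Computable a) ∧ ∀ p ∈ D, App a p (F p)

/-- `g n w`, if defined, is the value `F p n` for all `p ∈ D` that extend `w`, and it is defined
for all sufficiently long prefixes `w` of `p`. -/
structure Approximates (g : ℕ → List ℕ → Option ℕ) (F : Baire → Baire) (D : Set Baire) : Prop where
  sound : ∀ p ∈ D, ∀ n k m, g n (pre p k) = some m → F p n = m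
  complete : ∀ p ∈ D, ∀ n, ∃ K, ∀ k ≥ K, g n (pre p k) = some (F p n)

variable {c : Prop} {F G H : Baire → Baire} {D E : Set Baire}

/-- The associate answers a query by `g`, shifted by one, with `0` for an undefined value. By
soundness the first defined answer is already correct, so `g` need not be monotone in the prefix. -/
theorem EffOn.of_approx {g : ℕ → List ℕ → Option ℕ} (hg : c → Computable₂ g)
    (h : Approximates g F D) : EffOn c F D := by
  refine ⟨fun m => ((Encodable.decode (α := ℕ × List ℕ) m).bind
    fun x => (g x.1 x.2).map Nat.succ).getD 0, fun hc => ?_, fun p hp n => ?_⟩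
  · refine Computable.option_getD (Computable.option_bind Computable.decode ?_) (Computable.const 0)
    exact Computable.option_map ((hg hc).comp (Computable.fst.comp Computable.snd)
      (Computable.snd.comp Computable.snd)) (Computable.succ.comp Computable.snd)
  · classical
    have hex : ∃ k, (g n (pre p k)).isSome := by
      obtain ⟨K, hK⟩ := h.complete p hp n
      exact ⟨K, by simp [hK K le_rfl]⟩
    refine ⟨Nat.find hex, ?_, fun j hj => ?_⟩
    · obtain ⟨m, hm⟩ := Option.isSome_iff_exists.1 (Nat.find_spec hex)
      simp [queryCode_eq, hm, h.sound p hp n _ m hm]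
    · have := Nat.find_min hex hj
      simp only [Option.not_isSome_iff_eq_none] at this
      simp [queryCode_eq, this]

/-- After its first nonzero answer an associate may say anything. Hence `g n w` has to replay the
queries on the prefixes of `w` and use only the first nonzero answer. -/
theorem EffOn.approx (h : EffOn c F D) :
    ∃ g : ℕ → List ℕ → Option ℕ, (c → Computable₂ g) ∧ Approximates g F D := by
  obtain ⟨a, ha, h⟩ := h
  let P : ℕ → List ℕ → ℕ → Bool := fun n w j => a (Encodable.encode (n, w.take j)) == 0
  -- If all proper prefixes of `w` are answered by `0`, then `climb` returns `w.length` and `w`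
  -- itself is queried; an answer `0` there means undefined.
  let g : ℕ → List ℕ → Option ℕ := fun n w =>
    Nat.casesOn (a (Encodable.encode (n, w.take (climb (P n w) w.length)))) none some
  have hP : ∀ (p : Baire) (n k : ℕ), ∀ j ≤ k, P n (pre p k) j = (a (queryCode p j n) == 0) := by
    intro p n k j hj
    simp [P, queryCode_eq, take_pre p hj]
  have hg : ∀ (p : Baire) (n k : ℕ), g n (pre p k) =
      Nat.casesOn (a (queryCode p (climb (P n (pre p k)) k) n)) none some := by
    intro p n k
    simp only [g, length_pre, take_pre p (climb_le _ k), queryCode_eq]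
  refine ⟨g, fun hc => ?_, fun p hp n k m hm => ?_, fun p hp n => ?_⟩
  · have htake : ∀ {α : Type} [Primcodable α] {f : α → ℕ} {l : α → List ℕ} {e : α → ℕ},
        Computable f → Computable l → Computable e →
        Computable fun x => a (Encodable.encode (f x, (l x).take (e x))) := fun hf hl he =>
      (ha hc).comp (Computable.encode.comp (Computable.pair hf
        (Primrec.list_take.to_comp.comp he hl)))
    have hPc : Computable₂ fun (x : ℕ × List ℕ) (j : ℕ) => P x.1 x.2 j :=
      computable_beq_zero.comp (htake (Computable.fst.comp Computable.fst)
        (Computable.snd.comp Computable.fst) Computable.snd)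
    exact Computable.nat_casesOn (htake Computable.fst Computable.snd
      (computable_climb hPc (Computable.list_length.comp Computable.snd)))
      (Computable.const none) (Computable.option_some.comp Computable.snd)
  · obtain ⟨l, hl, hl'⟩ := h p hp n
    rw [hg] at hm
    set i := climb (P n (pre p k)) k with hi
    have hik : i ≤ k := climb_le _ _
    have hz : ∀ j < i, a (queryCode p j n) = 0 := fun j hj => by
      simpa [hP p n k j (hj.le.trans hik)] using of_lt_climb (P n (pre p k)) k j hj
    have hne : a (queryCode p i n) = m + 1 := by
      revert hm
      cases a (queryCode p i n) <;> simp
    rcases lt_trichotomy i l with hlt | heq | hlt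
    · have := hl' i hlt; omega
    · rw [heq] at hne; omega
    · have := hz l hlt; omega
  · obtain ⟨l, hl, hl'⟩ := h p hp n
    refine ⟨l, fun k hk => ?_⟩
    rw [hg, climb_eq (j := l) (by simp [hP p n k l hk, hl])
      (fun i hi => by simp [hP p n k i (hi.le.trans hk), hl' i hi]) hk, hl]

theorem EffOn.mono (h : EffOn c F D) (hE : E ⊆ D) : EffOn c F E :=
  let ⟨a, ha, h⟩ := h; ⟨a, ha, fun p hp => h p (hE hp)⟩

theorem EffOn.congr (h : EffOn c F D) (hFG : ∀ p ∈ D, F p = G p) : EffOn c G D :=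
  let ⟨a, ha, h⟩ := h; ⟨a, ha, fun p hp => hFG p hp ▸ h p hp⟩

theorem EffOn.id : EffOn c (fun p => p) D := by
  refine .of_approx (g := fun n w => w[n]?)
    (fun _ => Computable.list_getElem?.comp Computable.snd Computable.fst)
    ⟨fun p _ n k m h => ?_, fun p _ n => ⟨n + 1, fun k hk => ?_⟩⟩
  · rw [getElem?_pre] at h
    split_ifs at h
    exact Option.some.inj h
  · rw [getElem?_pre, if_pos (by omega)]

theorem EffOn.const_of {e : ℕ → ℕ} (he : c → Computable e) : EffOn c (fun _ n => e n) D :=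
  .of_approx (g := fun n _ => some (e n))
    (fun hc => Computable.option_some.comp ((he hc).comp Computable.fst))
    ⟨fun _ _ _ _ _ h => Option.some.inj h, fun _ _ _ => ⟨0, fun _ _ => rfl⟩⟩

theorem EffOn.const {e : ℕ → ℕ} (he : Computable e) : EffOn c (fun _ n => e n) D :=
  .const_of fun _ => he

/-- Evaluation of `G p` at arguments computed by `F p`. -/
theorem EffOn.apply (hG : EffOn c G D) (hF : EffOn c F D) : EffOn c (fun p n => G p (F p n)) D := by
  obtain ⟨g, hg, hgG⟩ := hG.approx
  obtain ⟨f, hf, hfF⟩ := hF.approx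
  refine .of_approx (g := fun n w => (f n w).bind fun m => g m w) (fun hc => ?_)
    ⟨fun p hp n k m h => ?_, fun p hp n => ?_⟩
  · exact Computable.option_bind (hf hc)
      ((hg hc).comp Computable.snd (Computable.snd.comp Computable.fst))
  · obtain ⟨i, hi, him⟩ := Option.bind_eq_some_iff.1 h
    rw [hfF.sound p hp n k i hi, hgG.sound p hp i k m him]
  · obtain ⟨K, hK⟩ := hfF.complete p hp n
    obtain ⟨L, hL⟩ := hgG.complete p hp (F p n)
    exact ⟨max K L, fun k hk => by
      simp [hK k (le_of_max_le_left hk), hL k (le_of_max_le_right hk)]⟩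

/-- Together with `EffOn.map` this yields all pointwise computable binary operations. -/
theorem EffOn.zip (hF : EffOn c F D) (hG : EffOn c G D) :
    EffOn c (fun p n => Nat.pair (F p n) (G p n)) D := by
  obtain ⟨g, hg, hgG⟩ := hG.approx
  obtain ⟨f, hf, hfF⟩ := hF.approx
  refine .of_approx (g := fun n w => (f n w).bind fun i => (g n w).map fun j => Nat.pair i j)
    (fun hc => ?_) ⟨fun p hp n k m h => ?_, fun p hp n => ?_⟩
  · exact Computable.option_bind (hf hc) (Computable.option_map ((hg hc).comp
      (Computable.fst.comp Computable.fst) (Computable.snd.comp Computable.fst))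
      (Primrec₂.natPair.to_comp.comp (Computable.snd.comp Computable.fst) Computable.snd))
  · obtain ⟨i, hi, him⟩ := Option.bind_eq_some_iff.1 h
    obtain ⟨j, hj, rfl⟩ := Option.map_eq_some_iff.1 him
    rw [hfF.sound p hp n k i hi, hgG.sound p hp n k j hj]
  · obtain ⟨K, hK⟩ := hfF.complete p hp n
    obtain ⟨L, hL⟩ := hgG.complete p hp n
    exact ⟨max K L, fun k hk => by
      simp [hK k (le_of_max_le_left hk), hL k (le_of_max_le_right hk)]⟩

/-- Codes of finite prefixes are effective. -/
theorem EffOn.prefixes : EffOn c (fun p k => Encodable.encode (pre p k)) D := by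
  refine .of_approx
    (g := fun n w => cond (decide (w.length < n)) none (some (Encodable.encode (w.take n))))
    (fun _ => ?_) ⟨fun p _ n k m h => ?_, fun p _ n => ⟨n, fun k hk => ?_⟩⟩
  · refine Computable.cond ?_ (Computable.const none) (Computable.option_some.comp
      (Computable.encode.comp (Primrec.list_take.to_comp.comp Computable.fst Computable.snd)))
    exact (Primrec.nat_lt.decide.comp (Primrec.list_length.comp Primrec.snd) Primrec.fst).to_comp
  · by_cases hk : k < n
    · simp [hk] at h
    · simpa [hk, take_pre p (not_lt.1 hk)] using h
  · simp [not_lt.2 hk, take_pre p hk]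

/-- Unbounded search. -/
theorem EffOn.search (hF : EffOn c F D) (S : Baire → Baire)
    (hS : ∀ p ∈ D, ∀ n, F p (Nat.pair n (S p n)) ≠ 0 ∧ ∀ j < S p n, F p (Nat.pair n j) = 0) :
    EffOn c S D := by
  obtain ⟨f, hf, hfF⟩ := hF.approx
  -- A candidate is passed over only when its value is known to be `0`. An unknown value stops the
  -- climb and leaves the result undefined, so no smaller solution is missed.
  let P : ℕ → List ℕ → ℕ → Bool := fun n w j => decide (f (Nat.pair n j) w = some 0)
  let C : ℕ → List ℕ → ℕ := fun n w => climb (P n w) w.length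
  refine .of_approx (g := fun n w => (f (Nat.pair n (C n w)) w).bind fun m =>
    cond (m == 0) none (some (C n w))) (fun hc => ?_) ⟨fun p hp n k m h => ?_, fun p hp n => ?_⟩
  · have hfc : ∀ {α : Type} [Primcodable α] {e : α → ℕ} {l : α → List ℕ} {i : α → ℕ},
        Computable e → Computable l → Computable i →
        Computable fun x => f (Nat.pair (e x) (i x)) (l x) := fun he hl hi =>
      (hf hc).comp (Primrec₂.natPair.to_comp.comp he hi) hl
    have hPc : Computable₂ fun (x : ℕ × List ℕ) (j : ℕ) => P x.1 x.2 j :=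
      Primrec.eq.decide.to_comp.comp (hfc (Computable.fst.comp Computable.fst)
        (Computable.snd.comp Computable.fst) Computable.snd) (Computable.const (some 0))
    have hC : Computable fun x : ℕ × List ℕ => C x.1 x.2 :=
      computable_climb hPc (Computable.list_length.comp Computable.snd)
    exact Computable.option_bind (hfc Computable.fst Computable.snd hC)
      (Computable.cond (computable_beq_zero.comp Computable.snd) (Computable.const none)
        (Computable.option_some.comp (hC.comp Computable.fst)))
  · obtain ⟨i, hi, him⟩ := Option.bind_eq_some_iff.1 h
    have hi0 : i ≠ 0 := by rintro rfl; simp at him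
    obtain rfl : C n (pre p k) = m := by
      obtain ⟨i, rfl⟩ := Nat.exists_eq_succ_of_ne_zero hi0
      simpa using him
    have hv := hfF.sound p hp _ k i hi
    have hz : ∀ j < C n (pre p k), F p (Nat.pair n j) = 0 := fun j hj =>
      hfF.sound p hp _ k 0 (by simpa [P] using of_lt_climb (P n (pre p k)) _ j hj)
    obtain ⟨h1, h2⟩ := hS p hp n
    rcases lt_trichotomy (S p n) (C n (pre p k)) with hlt | heq | hlt
    · exact absurd (hz _ hlt) h1
    · exact heq
    · exact absurd (h2 _ hlt) (hv ▸ hi0)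
  · choose K hK using fun j => hfF.complete p hp (Nat.pair n j)
    obtain ⟨h1, h2⟩ := hS p hp n
    -- The sum dominates each `K j` with `j ≤ S p n`; the extra summand lets the climb, bounded by
    -- the prefix length, reach `S p n`.
    refine ⟨S p n + ∑ j ∈ Finset.range (S p n + 1), K j, fun k hk => ?_⟩
    have hKk : ∀ j ≤ S p n, K j ≤ k := fun j hj => by
      have := Finset.single_le_sum (f := K) (fun _ _ => Nat.zero_le _)
        (Finset.mem_range.2 (Nat.lt_add_one_of_le hj))
      omega
    have hC : C n (pre p k) = S p n := by
      refine climb_eq ?_ (fun i hi => ?_) (by simp; omega)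
      · simp [P, hK _ k (hKk _ le_rfl), h1]
      · simp [P, hK _ k (hKk _ hi.le), h2 i hi]
    obtain ⟨i, hi⟩ := Nat.exists_eq_succ_of_ne_zero h1
    simp [hC, hK _ k (hKk _ le_rfl), hi]

/-- The prefix computed in `k` steps from a partial sequence. -/
def collectPrefix (f : ℕ → Option ℕ) (k : ℕ) : List ℕ :=
  Nat.rec [] (fun _ v => Option.casesOn (f v.length) v fun m => v ++ [m]) k

/-- Each step appends at most one entry, correct by `hf`, and cannot stall before position `l`. With
`l = 0` this says merely that the collected list is a prefix of `q`. -/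
theorem collectPrefix_eq {f : ℕ → Option ℕ} {q : Baire} (hf : ∀ i m, f i = some m → q i = m)
    {l : ℕ} (hl : ∀ i < l, f i = some (q i)) (k : ℕ) :
    ∃ j, min k l ≤ j ∧ collectPrefix f k = pre q j := by
  induction k with
  | zero => exact ⟨0, by simp, rfl⟩
  | succ k ih =>
    obtain ⟨j, hj, hjk⟩ := ih
    have hs : collectPrefix f (k + 1) = Option.casesOn (f (collectPrefix f k).length)
      (collectPrefix f k) fun m => collectPrefix f k ++ [m] := rfl
    rw [hs, hjk, length_pre]
    cases h : f j with
    | none =>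
      refine ⟨j, ?_, rfl⟩
      have : ¬ j < l := fun hjl => by simp [hl j hjl] at h
      omega
    | some m => exact ⟨j + 1, by omega, by rw [pre_succ, hf j m h]⟩

theorem computable_collectPrefix {α : Type*} [Primcodable α] {f : α → ℕ → Option ℕ} {k : α → ℕ}
    (hf : Computable₂ f) (hk : Computable k) : Computable fun a => collectPrefix (f a) (k a) := by
  have h : Computable₂ fun (a : α) (x : ℕ × List ℕ) =>
      (Option.casesOn (f a x.2.length) x.2 fun m => x.2 ++ [m] : List ℕ) :=
    Computable.option_casesOn (o := fun y : α × ℕ × List ℕ => f y.1 y.2.2.length)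
      (f := fun y => y.2.2) (g := fun y m => y.2.2 ++ [m])
      (hf.comp Computable.fst (Computable.list_length.comp (Computable.snd.comp Computable.snd)))
      (Computable.snd.comp Computable.snd)
      (Computable.list_concat.comp (Computable.snd.comp (Computable.snd.comp Computable.fst))
        Computable.snd)
  exact Computable.nat_rec hk (Computable.const []) h

/-- Substitution of a sequence of oracles. -/
theorem EffOn.subst (hG : EffOn c G E) (hF : EffOn c F D)
    (h : ∀ p ∈ D, ∀ a, (fun i => F p (Nat.pair a i)) ∈ E) :
    EffOn c (fun p m => G (fun i => F p (Nat.pair m.unpair.1 i)) m.unpair.2) D := by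
  obtain ⟨g, hg, hgG⟩ := hG.approx
  obtain ⟨f, hf, hfF⟩ := hF.approx
  let V : ℕ → List ℕ → List ℕ := fun a w => collectPrefix (fun i => f (Nat.pair a i) w) w.length
  refine .of_approx (g := fun n w => g n.unpair.2 (V n.unpair.1 w)) (fun hc => ?_)
    ⟨fun p hp n k m hm => ?_, fun p hp n => ?_⟩
  · have hV : Computable fun x : ℕ × List ℕ => V x.1 x.2 :=
      computable_collectPrefix ((hf hc).comp (Primrec₂.natPair.to_comp.comp
        (Computable.fst.comp Computable.fst) Computable.snd) (Computable.snd.comp Computable.fst))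
        (Computable.list_length.comp Computable.snd)
    clear_value V
    have hu : Computable fun x : ℕ × List ℕ => x.1.unpair := Computable.unpair.comp Computable.fst
    have hV' : Computable₂ V := hV
    exact (hg hc).comp (Computable.snd.comp hu) (hV'.comp (Computable.fst.comp hu) Computable.snd)
  · obtain ⟨j, -, hj⟩ := collectPrefix_eq (f := fun i => f (Nat.pair n.unpair.1 i) (pre p k))
      (q := fun i => F p (Nat.pair n.unpair.1 i))
      (fun i m hi => hfF.sound p hp _ k m hi) (l := 0) (by simp) (pre p k).length
    simp only [V, hj] at hm
    exact hgG.sound _ (h p hp _) _ j m hm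
  · obtain ⟨l, hl⟩ := hgG.complete _ (h p hp n.unpair.1) n.unpair.2
    choose K hK using fun i => hfF.complete p hp (Nat.pair n.unpair.1 i)
    refine ⟨l + ∑ i ∈ Finset.range l, K i, fun k hk => ?_⟩
    have hKk : ∀ i < l, K i ≤ k := fun i hi => by
      have := Finset.single_le_sum (f := K) (fun _ _ => Nat.zero_le _) (Finset.mem_range.2 hi)
      omega
    obtain ⟨j, hjl, hj⟩ := collectPrefix_eq (f := fun i => f (Nat.pair n.unpair.1 i) (pre p k))
      (q := fun i => F p (Nat.pair n.unpair.1 i))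
      (fun i m hi => hfF.sound p hp _ k m hi) (l := l) (fun i hi => hK i k (hKk i hi))
      (pre p k).length
    rw [length_pre] at hjl hj
    simp only [V, length_pre, hj]
    exact hl j (by omega)

/-- Case distinction: `T p 0` tells from which of the sets `D` and `E` the argument `p` is. -/
theorem EffOn.cases {T : Baire → Baire} (hT : EffOn c T (D ∪ E)) (hF : EffOn c F D)
    (hG : EffOn c G E) (hD : ∀ p ∈ D, T p 0 = 0) (hE : ∀ p ∈ E, T p 0 ≠ 0) :
    EffOn c (fun p => cond (T p 0 == 0) (F p) (G p)) (D ∪ E) := by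
  obtain ⟨t, ht, htT⟩ := hT.approx
  obtain ⟨f, hf, hfF⟩ := hF.approx
  obtain ⟨g, hg, hgG⟩ := hG.approx
  refine .of_approx (g := fun n w => (t 0 w).bind fun b => cond (b == 0) (f n w) (g n w))
    (fun hc => ?_) ⟨fun p hp n k m h => ?_, fun p hp n => ?_⟩
  · exact Computable.option_bind ((ht hc).comp (Computable.const 0) Computable.snd)
      (Computable.cond (computable_beq_zero.comp Computable.snd)
        ((hf hc).comp (Computable.fst.comp Computable.fst) (Computable.snd.comp Computable.fst))
        ((hg hc).comp (Computable.fst.comp Computable.fst) (Computable.snd.comp Computable.fst)))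
  · obtain ⟨i, hi, him⟩ := Option.bind_eq_some_iff.1 h
    have hTi := htT.sound p hp 0 k i hi
    rcases hp with hp | hp
    · obtain rfl : i = 0 := hTi ▸ hD p hp
      rw [hTi]
      exact hfF.sound p hp n k m him
    · obtain ⟨j, rfl⟩ := Nat.exists_eq_succ_of_ne_zero (hTi ▸ hE p hp)
      rw [hTi]
      exact hgG.sound p hp n k m him
  · obtain ⟨K, hK⟩ := htT.complete p hp 0
    rcases hp with hp | hp
    · obtain ⟨L, hL⟩ := hfF.complete p hp n
      exact ⟨max K L, fun k hk => by
        simp [hK k (le_of_max_le_left hk), hL k (le_of_max_le_right hk), hD p hp]⟩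
    · obtain ⟨L, hL⟩ := hgG.complete p hp n
      obtain ⟨j, hj⟩ := Nat.exists_eq_succ_of_ne_zero (hE p hp)
      exact ⟨max K L, fun k hk => by
        simp [hK k (le_of_max_le_left hk), hL k (le_of_max_le_right hk), hj]⟩

/-! ### Associates and continuity in the product topology -/

theorem hasBasis_nhds_pre (p : Baire) :
    (𝓝 p).HasBasis (fun _ => True) fun k => {q : Baire | pre q k = pre p k} := by
  refine ⟨fun s => ⟨fun hs => ?_, fun ⟨k, _, hk⟩ => Filter.mem_of_superset ?_ hk⟩⟩
  · obtain ⟨U, hU, hUo, hpU⟩ := mem_nhds_iff.1 hs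
    obtain ⟨I, u, hu, huU⟩ := isOpen_pi_iff.1 hUo p hpU
    refine ⟨I.sup _root_.id + 1, trivial, fun q hq => hU (huU fun i hi => ?_)⟩
    rw [pre_eq_pre.1 hq i (Nat.lt_succ_of_le (Finset.le_sup (f := _root_.id) hi))]
    exact (hu i hi).2
  · have : {q : Baire | pre q k = pre p k} = ⋂ i ∈ Set.Iio k, (fun q : Baire => q i) ⁻¹' {p i} := by
      ext; simp [pre_eq_pre]
    rw [this]
    exact ((Set.finite_Iio k).isOpen_biInter fun i _ =>
      (isOpen_discrete _).preimage (continuous_apply i)).mem_nhds (by simp)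

theorem effOn_true_iff : EffOn True F D ↔ ComputableFunOn F D := by
  simp [EffOn, ComputableFunOn]

/-- A function is continuous if and only if it has an associate. -/
theorem effOn_false_iff : EffOn False F D ↔ ContinuousOn F D := by
  classical
  have hcont : ContinuousOn F D ↔
      ∀ p ∈ D, ∀ n, ∃ k, ∀ q ∈ D, pre q k = pre p k → F q n = F p n := by
    refine forall₂_congr fun p hp => ?_
    rw [ContinuousWithinAt, tendsto_pi_nhds]
    refine forall_congr' fun n => ?_
    rw [nhds_discrete, Filter.tendsto_pure,
      (nhdsWithin_hasBasis (hasBasis_nhds_pre p) D).eventually_iff]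
    simp only [true_and, mem_inter_iff, mem_ofPred_eq]
    exact exists_congr fun k => ⟨fun h q hq hqp => h ⟨hqp, hq⟩, fun h q hq => h q hq.2 hq.1⟩
  rw [hcont]
  constructor
  · intro h p hp n
    obtain ⟨g, -, hg⟩ := h.approx
    obtain ⟨k, hk⟩ := hg.complete p hp n
    exact ⟨k, fun q hq hqp => hg.sound q hq n k _ (hqp ▸ hk k le_rfl)⟩
  · intro h
    -- `w` forces the value `m`. If no point of `D` extends `w`, every `m` is forced, which is
    -- harmless since approximations are tested only on prefixes of points of `D`. Choosing `m` is
    -- allowed because no computability is asked for.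
    let P : ℕ → List ℕ → ℕ → Prop := fun n w m => ∀ q ∈ D, pre q w.length = w → F q n = m
    refine .of_approx (g := fun n w => if hw : ∃ m, P n w m then some hw.choose else none)
      (fun hc => hc.elim) ⟨fun p hp n k m hm => ?_, fun p hp n => ?_⟩
    · split_ifs at hm with hw
      rw [← Option.some.inj hm]
      exact hw.choose_spec p hp (by simp)
    · obtain ⟨k, hk⟩ := h p hp n
      refine ⟨k, fun l hl => ?_⟩
      have hw : ∃ m, P n (pre p l) m := ⟨F p n, fun q hq hqp => hk q hq <| pre_eq_pre.2 fun i hi =>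
        pre_eq_pre.1 (by simpa using hqp) i (hi.trans_le hl)⟩
      rw [dif_pos hw, ← hw.choose_spec p hp (by simp)]

end Baire

namespace Baire

variable {c : Prop} {F G H : Baire → Baire} {D E : Set Baire}

open RepSpace (fstName sndName)

/-! ### Derived closure properties -/

theorem EffOn.reindex (hF : EffOn c F D) {e : ℕ → ℕ} (he : Computable e) :
    EffOn c (fun p n => F p (e n)) D :=
  hF.apply (.const he)

theorem EffOn.map (hF : EffOn c F D) {e : ℕ → ℕ} (he : Computable e) :
    EffOn c (fun p n => e (F p n)) D :=
  (EffOn.const he).apply hF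

theorem computable_unpair_fst : Computable fun n : ℕ => n.unpair.1 :=
  Computable.fst.comp Computable.unpair

theorem computable_unpair_snd : Computable fun n : ℕ => n.unpair.2 :=
  Computable.snd.comp Computable.unpair

/-- Substitution of a constant sequence of oracles, read off at index `0`. -/
theorem EffOn.comp (hG : EffOn c G E) (hF : EffOn c F D) (h : ∀ p ∈ D, F p ∈ E) :
    EffOn c (fun p => G (F p)) D := by
  have h1 := hG.subst (hF.reindex computable_unpair_snd) (fun p hp a => by simpa using h p hp)
  have h2 := h1.reindex (e := fun n => Nat.pair 0 n)
    (Primrec₂.natPair.comp (Primrec.const 0) Primrec.id).to_comp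
  simpa using h2

theorem EffOn.fst : EffOn c fstName D := EffOn.id.reindex Primrec.nat_double.to_comp

theorem EffOn.snd : EffOn c sndName D := EffOn.id.reindex Primrec.nat_double_succ.to_comp

/-- The interleaving of two sequences. -/
def pairName (p q : Baire) : Baire := fun n => if n % 2 = 0 then p (n / 2) else q (n / 2)

@[simp] theorem fstName_pairName (p q : Baire) : fstName (pairName p q) = p := by
  funext n; simp [fstName, pairName]

@[simp] theorem sndName_pairName (p q : Baire) : sndName (pairName p q) = q := by
  funext n
  have h : (2 * n + 1) / 2 = n := by omega
  simp [sndName, pairName, h]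

/-- The argument codes a position and two candidate values; the parity of the position decides, as
in `pairName`. -/
theorem computable_select :
    Computable fun m : ℕ => if m.unpair.1 % 2 = 0 then m.unpair.2.unpair.1
      else m.unpair.2.unpair.2 :=
  have hs : Primrec fun m : ℕ => m.unpair.2.unpair :=
    Primrec.unpair.comp (Primrec.snd.comp Primrec.unpair)
  (Primrec.ite (Primrec.eq.comp (Primrec.nat_mod.comp (Primrec.fst.comp Primrec.unpair)
    (Primrec.const 2)) (Primrec.const 0)) (Primrec.fst.comp hs) (Primrec.snd.comp hs)).to_comp

theorem computable_half : Computable fun n : ℕ => n / 2 :=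
  (Primrec.nat_div.comp Primrec.id (Primrec.const 2)).to_comp

theorem EffOn.pair (hF : EffOn c F D) (hG : EffOn c G D) :
    EffOn c (fun p => pairName (F p) (G p)) D := by
  have h := ((EffOn.const Computable.id).zip
    ((hF.reindex computable_half).zip (hG.reindex computable_half))).map computable_select
  simp only [Nat.unpair_pair] at h
  exact h

/-- Collecting the values at the constant sequences. -/
theorem EffOn.collect (hF : EffOn c F E) (h : ∀ p ∈ D, ∀ n, pairName p (fun _ => n) ∈ E) :
    EffOn c (fun p m => F (pairName p fun _ => m.unpair.1) m.unpair.2) D := by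
  have hm : Computable fun m : ℕ => m.unpair.2 / 2 := computable_half.comp computable_unpair_snd
  have h1 : EffOn c (fun p m => pairName p (fun _ => m.unpair.1) m.unpair.2) D := by
    have h := ((EffOn.const (c := c) computable_unpair_snd).zip (((EffOn.id (D := D)).reindex hm).zip
      (EffOn.const computable_unpair_fst))).map computable_select
    simp only [Nat.unpair_pair] at h
    exact h
  have h2 := hF.subst h1 (fun p hp a => by simpa using h p hp a)
  simpa using h2

/-! ### Application and currying of associates -/

/-- The value of the function with associate `a` at `q`, if defined. -/
noncomputable def app (a q : Baire) : Baire :=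
  open Classical in if h : ∃ s, App a q s then h.choose else fun _ => 0

theorem app_eq {a q s : Baire} (h : App a q s) : app a q = s := by
  have h' : ∃ s, App a q s := ⟨s, h⟩
  rw [app, dif_pos h']
  exact h'.choose_spec.unique h

theorem app_spec {a q : Baire} (h : ∃ s, App a q s) : App a q (app a q) := by
  obtain ⟨s, hs⟩ := h
  rwa [app_eq hs]

/-- Application is effective uniformly in the associate: query longer and longer prefixes of the
argument, search for the first nonzero answer, and subtract one. -/
theorem EffOn.app (hF : EffOn c F D) (hG : EffOn c G D) (h : ∀ p ∈ D, ∃ s, App (F p) (G p) s) :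
    EffOn c (fun p => app (F p) (G p)) D := by
  classical
  let S : Baire → Baire := fun p n =>
    if h : ∃ k, F p (queryCode (G p) k n) ≠ 0 then Nat.find h else 0
  have hQ : EffOn c (fun p m => F p (queryCode (G p) m.unpair.2 m.unpair.1)) D :=
    hF.apply ((EffOn.const computable_unpair_fst).zip
      ((EffOn.prefixes (D := univ)).comp hG (fun _ _ => mem_univ _) |>.reindex
        computable_unpair_snd))
  have hex : ∀ p ∈ D, ∀ n, ∃ k, F p (queryCode (G p) k n) ≠ 0 := fun p hp n => by
    obtain ⟨k, hk, -⟩ := app_spec (h p hp) n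
    exact ⟨k, by omega⟩
  have hS : EffOn c S D := by
    refine hQ.search S fun p hp n => ?_
    simp only [Nat.unpair_pair, S, dif_pos (hex p hp n)]
    exact ⟨Nat.find_spec (hex p hp n), fun j hj => not_not.1 (Nat.find_min (hex p hp n) hj)⟩
  refine ((hQ.apply ((EffOn.const Computable.id).zip hS)).map Computable.pred).congr
    fun p hp => funext fun n => ?_
  obtain ⟨k, hk, hk'⟩ := app_spec (h p hp) n
  have hSk : S p n = k := by
    simp only [S, dif_pos (hex p hp n)]
    exact (Nat.find_eq_iff _).2 ⟨by omega, fun j hj => not_not.2 (hk' j hj)⟩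
  simp [hSk, hk]

/-- The interleaving of two lists, up to the length of the second. -/
def interleave (u v : List ℕ) : List ℕ :=
  (List.range (2 * v.length)).map fun i =>
    if i % 2 = 0 then (u[i / 2]?).getD 0 else (v[i / 2]?).getD 0

theorem interleave_pre (p q : Baire) (k : ℕ) :
    interleave (pre p k) (pre q k) = pre (pairName p q) (2 * k) := by
  rw [interleave, length_pre]
  change _ = List.map _ _
  refine List.map_congr_left fun i hi => ?_
  have : i / 2 < k := by have := List.mem_range.1 hi; omega
  simp only [pairName, getElem?_pre, if_pos this, Option.getD_some]

theorem primrec_interleave : Primrec₂ interleave := by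
  have hi : Primrec fun x : (List ℕ × List ℕ) × ℕ => x.2 / 2 :=
    Primrec.nat_div.comp Primrec.snd (Primrec.const 2)
  refine Primrec.list_map (Primrec.list_range.comp
    (Primrec.nat_double.comp (Primrec.list_length.comp Primrec.snd))) ?_
  exact Primrec.ite (Primrec.eq.comp (Primrec.nat_mod.comp Primrec.snd (Primrec.const 2))
      (Primrec.const 0))
    (Primrec.option_getD.comp (Primrec.list_getElem?.comp (Primrec.fst.comp Primrec.fst) hi)
      (Primrec.const 0))
    (Primrec.option_getD.comp (Primrec.list_getElem?.comp (Primrec.snd.comp Primrec.fst) hi)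
      (Primrec.const 0))

/-- Currying: associates of the sections of an effective function are effective. -/
theorem EffOn.curry (hF : EffOn c F D) : ∃ G, EffOn c G univ ∧
    ∀ p q, pairName p q ∈ D → App (G p) q (F (pairName p q)) := by
  obtain ⟨g, hg, hgF⟩ := hF.approx
  let dec : ℕ → ℕ × List ℕ := Denumerable.ofNat (ℕ × List ℕ)
  have hdec : Computable dec := Computable.ofNat _
  -- A query carries only a prefix `v` of `q`. The associate `G p` supplies the prefix `u` of `p` of
  -- equal length, so each of its entries depends on finitely many entries of `p`.
  let ans : ℕ → List ℕ → List ℕ → ℕ := fun n u v => ((g n (interleave u v)).map Nat.succ).getD 0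
  refine ⟨fun p m => ans (dec m).1 (pre p (dec m).2.length) (dec m).2, ?_, fun p q hpq n => ?_⟩
  · let e : ℕ → ℕ := fun m =>
      ans (dec m.unpair.1).1 (Denumerable.ofNat (List ℕ) m.unpair.2) (dec m.unpair.1).2
    have he : c → Computable e := fun hc => by
      have h1 : Computable fun m : ℕ => dec m.unpair.1 := hdec.comp computable_unpair_fst
      have h2 : Computable fun m : ℕ => Denumerable.ofNat (List ℕ) m.unpair.2 :=
        (Computable.ofNat _).comp computable_unpair_snd
      exact Computable.option_getD (Computable.option_map ((hg hc).comp (Computable.fst.comp h1)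
        (primrec_interleave.to_comp.comp h2 (Computable.snd.comp h1)))
        (Computable.succ.comp Computable.snd)) (Computable.const 0)
    have hl : Computable fun m => (dec m).2.length :=
      Computable.list_length.comp (Computable.snd.comp hdec)
    have h := (EffOn.const_of he).apply ((EffOn.const (D := univ) Computable.id).zip
      (EffOn.prefixes.reindex hl))
    simpa [e] using h
  · have hd : ∀ k, dec (queryCode q k n) = (n, pre q k) := fun k => by
      rw [queryCode_eq]; exact Denumerable.ofNat_encode _
    have hans : ∀ k, ans n (pre p k) (pre q k) =
        ((g n (pre (pairName p q) (2 * k))).map Nat.succ).getD 0 := fun k => by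
      simp only [ans, interleave_pre]
    classical
    have hex : ∃ k, (g n (pre (pairName p q) (2 * k))).isSome := by
      obtain ⟨K, hK⟩ := hgF.complete _ hpq n
      exact ⟨K, by simp [hK (2 * K) (by omega)]⟩
    refine ⟨Nat.find hex, ?_, fun j hj => ?_⟩
    · obtain ⟨m, hm⟩ := Option.isSome_iff_exists.1 (Nat.find_spec hex)
      simp [hd, hans, hm, hgF.sound _ hpq n _ m hm]
    · have := Nat.find_min hex hj
      simp only [Option.not_isSome_iff_eq_none] at this
      simp [hd, hans, this]

end Baire

namespace RepSpace

open Baire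

variable {α : Type u} {β : Type v} {c : Prop} {H : Baire → Baire} {D E : Set Baire}

/-! ### Observations through neighborhood filters -/

/-- The neighborhood map is an embedding that is effective both ways. -/
def IsKolmogorov (c : Prop) (X : RepSpace α) : Prop :=
  IsEmbeddingWrt (EffOn c) X X.opens.opens X.nbhdMap

theorem isKolmogorov_true_iff {X : RepSpace α} : X.IsKolmogorov True ↔ X.IsComputableKolmogorov := by
  rw [IsKolmogorov, IsComputableKolmogorov,
    show EffOn True = ComputableFunOn from funext₂ fun _ _ => propext effOn_true_iff]

theorem isKolmogorov_false_iff {X : RepSpace α} :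
    X.IsKolmogorov False ↔ X.IsContinuousKolmogorov := by
  rw [IsKolmogorov, IsContinuousKolmogorov,
    show EffOn False = fun F D => ContinuousOn F D from
      funext₂ fun _ _ => propext effOn_false_iff]

/-- Names of maps are constructed by currying. `G` is total, whatever `p` is; `p` must be suitable
only for `G p` to be a name. -/
theorem exists_fn_curry (X : RepSpace α) (Y : RepSpace β) (hH : EffOn c H E) :
    ∃ G, EffOn c G univ ∧ ∀ p (f : X.Pt → β),
      (∀ q x, X.Names q x.1 → pairName p q ∈ E ∧ Y.Names (H (pairName p q)) (f x)) →
      (fn X Y).Names (G p) f := by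
  obtain ⟨G, hG, hGE⟩ := hH.curry
  exact ⟨G, hG, fun p f hf q x hq => ⟨_, hGE p q (hf q x hq).1, (hf q x hq).2⟩⟩

theorem names_app {X : RepSpace α} {Y : RepSpace β} {f : X.Pt → β} {p q : Baire} {x : X.Pt}
    (hp : (fn X Y).Names p f) (hq : X.Names q x.1) : Y.Names (app p q) (f x) := by
  obtain ⟨r, hr, hr'⟩ := hp q x hq
  rwa [app_eq hr]

theorem exists_app {X : RepSpace α} {Y : RepSpace β} {f : X.Pt → β} {p q : Baire} {x : X.Pt}
    (hp : (fn X Y).Names p f) (hq : X.Names q x.1) : ∃ s, App p q s :=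
  let ⟨r, hr, _⟩ := hp q x hq; ⟨r, hr⟩

theorem names_app_opens {X : RepSpace α} {U : Set X.Pt} {p q : Baire} {x : X.Pt}
    (hp : X.opens.Names p U) (hq : X.Names q x.1) : sierpinski.Names (app p q) (x ∈ U) :=
  names_app (f := fun x => x ∈ U) hp hq

theorem exists_app_opens {X : RepSpace α} {U : Set X.Pt} {p q : Baire} {x : X.Pt}
    (hp : X.opens.Names p U) (hq : X.Names q x.1) : ∃ s, App p q s :=
  exists_app (f := fun x => x ∈ U) hp hq

/-- `p` is a name of the neighborhood filter of `x`. -/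
def IsNbhdName (X : RepSpace α) (p : Baire) (x : X.Pt) : Prop :=
  X.opens.opens.Names p (X.nbhdMap x)

theorem exists_nbhdMap_realizer (c : Prop) (X : RepSpace α) :
    ∃ F, EffOn c F univ ∧ ∀ p (x : X.Pt), X.Names p x.1 → X.IsNbhdName (F p) x := by
  have hev : EffOn c (fun r => app (sndName r) (fstName r))
      {r | ∃ s, App (sndName r) (fstName r) s} := EffOn.app .snd .fst fun _ h => h
  obtain ⟨F, hF, hFn⟩ := exists_fn_curry X.opens sierpinski hev
  refine ⟨F, hF, fun p x hp => hFn p _ fun q U hq => ?_⟩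
  simp only [mem_ofPred_eq, fstName_pairName, sndName_pairName]
  exact ⟨exists_app_opens hq hp, names_app_opens hq hp⟩

/-- Only the inverse matters: the forward realizer always exists, and if `x` and `y` have the same
filter, `G` sends a common filter name to a name of both. -/
theorem isKolmogorov_iff {X : RepSpace α} : X.IsKolmogorov c ↔
    ∃ G, EffOn c G {p | ∃ x, X.IsNbhdName p x} ∧ ∀ p x, X.IsNbhdName p x → X.Names (G p) x.1 := by
  refine ⟨fun h => h.2.2, fun ⟨G, hG, hGn⟩ => ?_⟩
  obtain ⟨F, hF, hFn⟩ := exists_nbhdMap_realizer c X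
  refine ⟨fun x y hxy => ?_, ⟨F, hF.mono (subset_univ _), hFn⟩, G, hG, hGn⟩
  obtain ⟨p, hp⟩ := x.2
  have hx := hFn p x hp
  have hy : X.IsNbhdName (F p) y := by rw [IsNbhdName, ← hxy]; exact hx
  exact Subtype.ext (X.unique (hGn _ x hx) (hGn _ y hy))

/-- Effectively open properties with a parameter can be decided positively from names of
neighborhood filters. -/
theorem exists_observe (Z : RepSpace α) (hH : EffOn c H E) {R : Baire → Z.Pt → Prop}
    (h : ∀ q ∈ D, ∀ t z, Z.Names t z.1 →
      pairName q t ∈ E ∧ sierpinski.Names (H (pairName q t)) (R q z)) :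
    ∃ K, EffOn c K {r | (∃ z, Z.IsNbhdName (fstName r) z) ∧ sndName r ∈ D} ∧
      ∀ p z, ∀ q ∈ D, Z.IsNbhdName p z → sierpinski.Names (K (pairName p q)) (R q z) := by
  obtain ⟨G, hG, hGn⟩ := exists_fn_curry Z sierpinski hH
  have hop : ∀ q ∈ D, Z.opens.Names (G q) {z | R q z} := fun q hq =>
    hGn q _ fun t z ht => h q hq t z ht
  have key : ∀ p z, ∀ q ∈ D, Z.IsNbhdName p z →
      (∃ s, App p (G q) s) ∧ sierpinski.Names (app p (G q)) (R q z) := fun p z q hq hp => by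
    -- This open set belongs to the filter of `z` exactly if `R q z` holds, so applying the filter
    -- name to `G q` observes `R q z`.
    have hU : Z.opens.Names (G q) (⟨{z | R q z}, G q, hop q hq⟩ : Z.opens.Pt).1 := hop q hq
    exact ⟨exists_app_opens (U := Z.nbhdMap z) hp hU, names_app_opens (U := Z.nbhdMap z) hp hU⟩
  refine ⟨fun r => app (fstName r) (G (sndName r)),
    EffOn.app .fst (hG.comp .snd fun _ _ => mem_univ _) ?_, fun p z q hq hp => ?_⟩
  · rintro r ⟨⟨z, hz⟩, hq⟩
    exact (key _ z _ hq hz).1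
  · simpa using (key p z q hq hp).2

/-- In a Kolmogorov space, names of points are computed from names of neighborhood filters. -/
theorem IsKolmogorov.exists_point {Y : RepSpace β} (hY : Y.IsKolmogorov c) (hH : EffOn c H E)
    {rel : Baire → Y.Pt → Prop}
    (h : ∀ p y, rel p y → ∀ u (V : Y.opens.Pt), Y.opens.Names u V.1 →
      pairName p u ∈ E ∧ sierpinski.Names (H (pairName p u)) (y ∈ V.1)) :
    ∃ K, EffOn c K {p | ∃ y, rel p y} ∧ ∀ p y, rel p y → Y.Names (K p) y.1 := by
  obtain ⟨G, hG, hGn⟩ := exists_fn_curry Y.opens sierpinski hH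
  obtain ⟨I, hI, hIn⟩ := isKolmogorov_iff.1 hY
  have hN : ∀ p y, rel p y → Y.IsNbhdName (G p) y := fun p y hp =>
    hGn p _ fun u V hu => h p y hp u V hu
  exact ⟨fun p => I (G p), hI.comp (hG.mono (subset_univ _)) fun p ⟨y, hy⟩ => ⟨y, hN p y hy⟩,
    fun p y hp => hIn _ y (hN p y hp)⟩

/-- Effective maps with a parameter into a Kolmogorov space can be evaluated at names of
neighborhood filters. -/
theorem IsKolmogorov.exists_recover {Y : RepSpace β} (hY : Y.IsKolmogorov c) (Z : RepSpace α)
    (hH : EffOn c H E) {f : D → Z.Pt → Y.Pt}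
    (h : ∀ (q : D) t z, Z.Names t z.1 →
      pairName q t ∈ E ∧ Y.Names (H (pairName q t)) (f q z).1) :
    ∃ K, EffOn c K {r | (∃ z, Z.IsNbhdName (fstName r) z) ∧ sndName r ∈ D} ∧
      ∀ p z (q : D), Z.IsNbhdName p z → Y.Names (K (pairName p q)) (f q z).1 := by
  -- The observation parameter `v` pairs `q` with a name of an open `V`; the property is `f q z ∈
  -- V`.
  let R : Baire → Z.Pt → Prop := fun v z => ∃ (hq : fstName v ∈ D) (V : Y.opens.Pt),
    Y.opens.Names (sndName v) V.1 ∧ f ⟨_, hq⟩ z ∈ V.1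
  have hR : ∀ (q : D) u (V : Y.opens.Pt) z, Y.opens.Names u V.1 →
      (R (pairName q u) z ↔ f q z ∈ V.1) := by
    intro q u V z hu
    simp only [R, fstName_pairName, sndName_pairName]
    refine ⟨fun ⟨_, V', hV', hf⟩ => ?_, fun hf => ⟨q.2, V, hu, hf⟩⟩
    rwa [← Y.opens.unique hV' hu]
  -- The input is `((q, u), t)`: the name `u` of `V` is applied to the name of `f q z` computed from
  -- `q` and `t`.
  have hH' : EffOn c
      (fun r => app (sndName (fstName r)) (H (pairName (fstName (fstName r)) (sndName r))))
      {r | pairName (fstName (fstName r)) (sndName r) ∈ E ∧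
        ∃ s, App (sndName (fstName r)) (H (pairName (fstName (fstName r)) (sndName r))) s} := by
    refine EffOn.app ((EffOn.snd (D := univ)).comp .fst fun _ _ => mem_univ _)
      (hH.comp (.pair ((EffOn.fst (D := univ)).comp .fst fun _ _ => mem_univ _) .snd)
        fun r hr => hr.1) fun r hr => hr.2
  obtain ⟨K, hK, hKn⟩ := exists_observe (R := R) Z hH'
      (D := {v | fstName v ∈ D ∧ ∃ V : Y.opens.Pt, Y.opens.Names (sndName v) V.1}) <| by
    rintro v ⟨hq, V, hV⟩ t z ht
    obtain ⟨h1, h2⟩ := h ⟨_, hq⟩ t z ht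
    simp only [mem_ofPred_eq, fstName_pairName, sndName_pairName]
    refine ⟨⟨h1, exists_app_opens hV h2⟩, ?_⟩
    have : R v z = (f ⟨_, hq⟩ z ∈ V.1) := propext
      ⟨fun ⟨_, V', hV'', hf⟩ => by rwa [← Y.opens.unique hV'' hV], fun hf => ⟨hq, V, hV, hf⟩⟩
    rw [this]
    exact names_app_opens hV h2
  -- Regrouping `((p, q), u)` as `(p, (q, u))`, so that currying in `u` gives a filter name of `f q
  -- z` from `p` and `q`.
  have hK' : EffOn c
      (fun r => K (pairName (fstName (fstName r)) (pairName (sndName (fstName r)) (sndName r))))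
      {r | ((∃ z, Z.IsNbhdName (fstName (fstName r)) z) ∧ sndName (fstName r) ∈ D) ∧
        ∃ V : Y.opens.Pt, Y.opens.Names (sndName r) V.1} := by
    refine hK.comp (.pair ((EffOn.fst (D := univ)).comp .fst fun _ _ => mem_univ _)
      (.pair ((EffOn.snd (D := univ)).comp .fst fun _ _ => mem_univ _) .snd)) ?_
    rintro r ⟨⟨hz, hq⟩, hV⟩
    simp only [mem_ofPred_eq, fstName_pairName, sndName_pairName]
    exact ⟨hz, hq, hV⟩
  obtain ⟨L, hL, hLn⟩ := hY.exists_point hK'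
      (rel := fun r y => ∃ (z : Z.Pt) (hq : sndName r ∈ D), Z.IsNbhdName (fstName r) z ∧
        y = f ⟨_, hq⟩ z) <| by
    rintro r _ ⟨z, hq, hz, rfl⟩ u V hu
    simp only [mem_ofPred_eq, fstName_pairName, sndName_pairName]
    refine ⟨⟨⟨⟨z, hz⟩, hq⟩, V, hu⟩, ?_⟩
    have hk := hKn (fstName r) z (pairName (sndName r) u) ⟨by simpa using hq, V, by simpa using hu⟩
      hz
    rwa [hR ⟨_, hq⟩ u V z hu] at hk
  refine ⟨L, hL.mono ?_, fun p z q hp => hLn _ _ ⟨z, ?_, ?_, ?_⟩⟩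
  · rintro r ⟨⟨z, hz⟩, hq⟩
    exact ⟨_, z, hq, hz, rfl⟩
  · simp
  · simpa using hp
  · simp

/-- The version of `exists_recover` without parameters. -/
theorem IsKolmogorov.exists_recover_map {Y : RepSpace β} (hY : Y.IsKolmogorov c) (Z : RepSpace α)
    (hH : EffOn c H Z.dom) {f : Z.Pt → Y.Pt} (h : ∀ t z, Z.Names t z.1 → Y.Names (H t) (f z).1) :
    ∃ K, EffOn c K {p | ∃ z, Z.IsNbhdName p z} ∧
      ∀ p z, Z.IsNbhdName p z → Y.Names (K p) (f z).1 := by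
  obtain ⟨K, hK, hKn⟩ := hY.exists_recover Z (D := univ) (f := fun _ => f)
    (hH.comp (D := {r | sndName r ∈ Z.dom}) .snd fun _ h => h) <| by
    intro q t z ht
    simp only [mem_ofPred_eq, sndName_pairName]
    exact ⟨⟨_, ht⟩, h t z ht⟩
  -- The parameter is irrelevant; `p` itself serves as a dummy.
  refine ⟨fun p => K (pairName p p), hK.comp (.pair .id .id) ?_,
    fun p z hp => hKn p z ⟨p, trivial⟩ hp⟩
  rintro p ⟨z, hz⟩
  simp only [mem_ofPred_eq, fstName_pairName]
  exact ⟨⟨z, hz⟩, trivial⟩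

/-- The version of `exists_observe` without parameters. -/
theorem exists_observe_set (Z : RepSpace α) (hH : EffOn c H Z.dom) {S : Set Z.Pt}
    (h : ∀ t z, Z.Names t z.1 → sierpinski.Names (H t) (z ∈ S)) :
    ∃ K, EffOn c K {p | ∃ z, Z.IsNbhdName p z} ∧
      ∀ p z, Z.IsNbhdName p z → sierpinski.Names (K p) (z ∈ S) := by
  obtain ⟨K, hK, hKn⟩ := exists_observe Z (D := univ) (R := fun _ z => z ∈ S)
    (hH.comp (D := {r | sndName r ∈ Z.dom}) .snd fun _ h => h) <| by
    intro q _ t z ht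
    simp only [mem_ofPred_eq, sndName_pairName]
    exact ⟨⟨_, ht⟩, h t z ht⟩
  refine ⟨fun p => K (pairName p p), hK.comp (.pair .id .id) ?_,
    fun p z hp => hKn p z p trivial hp⟩
  rintro p ⟨z, hz⟩
  simp only [mem_ofPred_eq, fstName_pairName]
  exact ⟨⟨z, hz⟩, trivial⟩

/-! ### Constructions -/

theorem IsKolmogorov.prod {X : RepSpace α} {Y : RepSpace β} (hX : X.IsKolmogorov c)
    (hY : Y.IsKolmogorov c) : (X.prod Y).IsKolmogorov c := by
  obtain ⟨K, hK, hKn⟩ := hX.exists_recover_map (X.prod Y) .fst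
    (f := fun z => ⟨z.1.1, z.2.imp' _ fun _ h => h.1⟩) fun t z ht => ht.1
  obtain ⟨L, hL, hLn⟩ := hY.exists_recover_map (X.prod Y) .snd
    (f := fun z => ⟨z.1.2, z.2.imp' _ fun _ h => h.2⟩) fun t z ht => ht.2
  refine isKolmogorov_iff.2 ⟨fun p => pairName (K p) (L p), hK.pair hL, fun p z hp => ⟨?_, ?_⟩⟩
  · simpa using hKn p z hp
  · simpa using hLn p z hp

theorem IsKolmogorov.meet {X Y : RepSpace α} (hX : X.IsKolmogorov c)
    (hY : Y.IsKolmogorov c) : (X.meet Y).IsKolmogorov c := by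
  obtain ⟨K, hK, hKn⟩ := hX.exists_recover_map (X.meet Y) .fst
    (f := fun z => ⟨z.1, z.2.imp' _ fun _ h => h.1⟩) fun t z ht => ht.1
  obtain ⟨L, hL, hLn⟩ := hY.exists_recover_map (X.meet Y) .snd
    (f := fun z => ⟨z.1, z.2.imp' _ fun _ h => h.2⟩) fun t z ht => ht.2
  refine isKolmogorov_iff.2 ⟨fun p => pairName (K p) (L p), hK.pair hL, fun p z hp => ⟨?_, ?_⟩⟩
  · simpa using hKn p z hp
  · simpa using hLn p z hp

/-- Recover the point along the inclusion. Membership in `Z` is a property of the point, so its name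
in `X` is also one in the subspace. -/
theorem IsKolmogorov.subspace {X : RepSpace α} (hX : X.IsKolmogorov c) (Z : Set α) :
    (X.subspace Z).IsKolmogorov c := by
  obtain ⟨K, hK, hKn⟩ := hX.exists_recover_map (X.subspace Z) .id
    (f := fun z => ⟨z.1, z.2.imp fun _ h => h.1⟩) fun t z ht => ht.1
  exact isKolmogorov_iff.2 ⟨K, hK, fun p z hp => ⟨hKn p z hp, z.2.elim fun _ h => h.2⟩⟩

/-- Evaluation at `n` is effective with `n` as a parameter, passed as a constant sequence. The
components recovered for all `n` are then collected into one name. -/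
theorem IsKolmogorov.seqPow {Y : RepSpace β} (hY : Y.IsKolmogorov c) :
    Y.seqPow.IsKolmogorov c := by
  have hH : EffOn c (fun r k => sndName r (Nat.pair (fstName r 0) k)) univ :=
    EffOn.snd.apply ((EffOn.fst.reindex (Computable.const 0)).zip (EffOn.const Computable.id))
  obtain ⟨K, hK, hKn⟩ := hY.exists_recover Y.seqPow (D := univ) hH
    (f := fun q z => ⟨z.1 (q.1 0), z.2.imp' _ fun _ h => h (q.1 0)⟩) fun q t z ht =>
      ⟨trivial, by simpa using ht (q.1 0)⟩
  refine isKolmogorov_iff.2 ⟨_, hK.collect ?_, fun p z hp n => ?_⟩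
  · rintro p ⟨z, hz⟩ n
    simp only [mem_ofPred_eq, fstName_pairName]
    exact ⟨⟨z, hz⟩, trivial⟩
  · simpa using hKn p z ⟨fun _ => n, trivial⟩ hp

/-- With a name `q` of `x` as parameter, the value at `x` is recovered from a filter name of the
function; currying in `q` gives a name of the function. -/
protected theorem IsKolmogorov.fn (X : RepSpace α) {Y : RepSpace β} (hY : Y.IsKolmogorov c) :
    (fn X Y).IsKolmogorov c := by
  have hH : EffOn c (fun r => app (sndName r) (fstName r))
      {r | ∃ s, App (sndName r) (fstName r) s} := EffOn.app .snd .fst fun _ h => h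
  obtain ⟨K, hK, hKn⟩ := hY.exists_recover (X.fn Y) hH (D := X.dom)
    (f := fun q z => ⟨z.1 (X.rep q), z.2.imp' _ fun _ h => names_app h (X.names_rep q)⟩) <| by
    intro q t z ht
    simp only [mem_ofPred_eq, fstName_pairName, sndName_pairName]
    exact ⟨exists_app ht (X.names_rep q), names_app ht (X.names_rep q)⟩
  obtain ⟨G, hG, hGn⟩ := exists_fn_curry X Y hK
  refine isKolmogorov_iff.2 ⟨G, hG.mono (subset_univ _), fun p z hp => hGn p _ fun q x hq => ?_⟩
  have hqd : q ∈ X.dom := ⟨_, hq⟩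
  simp only [mem_ofPred_eq, fstName_pairName, sndName_pairName]
  refine ⟨⟨⟨z, hp⟩, hqd⟩, ?_⟩
  rw [← X.rep_eq (p := ⟨q, hqd⟩) hq]
  exact hKn p z ⟨q, hqd⟩ hp

/-! ### Hyperspaces -/

/-- Spaces whose points are represented through maps into Sierpiński space. -/
theorem isKolmogorov_of_names_iff {Z : RepSpace α} {W : RepSpace β} (φ : α → W.Pt → Prop)
    (h : ∀ p (z : Z.Pt), Z.Names p z.1 ↔ (W.fn sierpinski).Names p (φ z.1)) :
    Z.IsKolmogorov c := by
  have hH : EffOn c (fun r => app (sndName r) (fstName r))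
      {r | ∃ s, App (sndName r) (fstName r) s} := EffOn.app .snd .fst fun _ h => h
  obtain ⟨K, hK, hKn⟩ := exists_observe Z hH (D := W.dom)
    (R := fun q z => ∃ hq : q ∈ W.dom, φ z.1 (W.rep ⟨q, hq⟩)) <| by
    intro q hq t z ht
    have hφ := (h t z).1 ht
    simp only [mem_ofPred_eq, fstName_pairName, sndName_pairName, exists_prop_of_true hq]
    exact ⟨exists_app hφ (W.names_rep ⟨q, hq⟩), names_app hφ (W.names_rep ⟨q, hq⟩)⟩
  obtain ⟨G, hG, hGn⟩ := exists_fn_curry W sierpinski hK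
  refine isKolmogorov_iff.2 ⟨G, hG.mono (subset_univ _),
    fun p z hp => (h _ z).2 (hGn p _ fun q w hq => ?_)⟩
  have hqd : q ∈ W.dom := ⟨_, hq⟩
  have hk := hKn p z q hqd hp
  rw [exists_prop_of_true hqd, W.rep_eq (p := ⟨q, hqd⟩) hq] at hk
  simp only [mem_ofPred_eq, fstName_pairName, sndName_pairName]
  exact ⟨⟨⟨z, hp⟩, hqd⟩, hk⟩

theorem isKolmogorov_opens (c : Prop) (X : RepSpace α) : X.opens.IsKolmogorov c :=
  isKolmogorov_of_names_iff (W := X) (fun U x => x ∈ U) fun _ _ => Iff.rfl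

theorem isKolmogorov_closedNeg (c : Prop) (X : RepSpace α) : X.closedNeg.IsKolmogorov c :=
  isKolmogorov_of_names_iff (W := X) (fun A x => x ∈ Aᶜ) fun _ _ => Iff.rfl

/-- Closedness is a condition on the point and not on the name, so any one name of `A` provides it.
-/
theorem isKolmogorov_closedPos (c : Prop) (X : RepSpace α) : X.closedPos.IsKolmogorov c :=
  isKolmogorov_of_names_iff (W := X.opens) (fun A U => (A ∩ U.1).Nonempty) fun _ A =>
    ⟨fun h => h.2, fun h => ⟨A.2.elim fun _ h => h.1, h⟩⟩

theorem isKolmogorov_compactNeg (c : Prop) (X : RepSpace α) : X.compactNeg.IsKolmogorov c :=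
  isKolmogorov_of_names_iff (W := X.opens) (fun K U => K ⊆ U.1) fun _ K =>
    ⟨fun h => h.2.2, fun h => ⟨K.2.elim fun _ h => h.1, K.2.elim fun _ h => h.2.1, h⟩⟩

/-! ### Coproducts -/

/-- Recovering the point of a summand that is marked by the first entry of the names. -/
theorem IsKolmogorov.exists_recover_summand {X : RepSpace β} (hX : X.IsKolmogorov c)
    (Z : RepSpace α) (i : X.Pt → Z.Pt) (hi : Function.Injective i) (τ : ℕ)
    (h : ∀ t z, Z.Names t z.1 →
      (t 0 = τ ∧ ∃ x, z = i x ∧ X.Names (fun n => t (n + 1)) x.1) ∨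
      (t 0 ≠ τ ∧ ∀ x, z ≠ i x)) :
    ∃ K, EffOn c K {p | ∃ x, Z.IsNbhdName p (i x)} ∧
      ∀ p x, Z.IsNbhdName p (i x) → X.Names (K p) x.1 := by
  have hsel : Computable fun n : ℕ => if n = τ then 0 else 1 :=
    (Primrec.ite (Primrec.eq.comp Primrec.id (Primrec.const τ)) (Primrec.const 0)
      (Primrec.const 1)).to_comp
  have hT : EffOn c (fun r _ => if sndName r 0 = τ then 0 else 1) univ :=
    (EffOn.snd.reindex (Computable.const 0)).map hsel
  have hF : EffOn c (fun r => app (fstName r) (fun n => sndName r (n + 1)))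
      {r | sndName r 0 = τ ∧ ∃ s, App (fstName r) (fun n => sndName r (n + 1)) s} :=
    EffOn.app .fst (EffOn.snd.reindex Computable.succ) fun r hr => hr.2
  -- On a foreign tag the output is the zero sequence, which names `False`.
  have hC := (hT.mono (subset_univ _)).cases hF
    (EffOn.const (D := {r | sndName r 0 ≠ τ}) (Computable.const 0))
    (fun r hr => if_pos hr.1) (fun r hr => by simpa using hr)
  -- The observed property is that `z` lies in the image under `i` of the open set named by `u`.
  obtain ⟨K, hK, hKn⟩ := exists_observe Z hC (D := X.opens.dom)
    (R := fun u z => ∃ x, z = i x ∧ ∃ V : X.opens.Pt, X.opens.Names u V.1 ∧ x ∈ V.1) <| by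
    rintro u ⟨V, hV⟩ t z ht
    simp only [mem_union, mem_ofPred_eq, fstName_pairName, sndName_pairName]
    rcases h t z ht with ⟨h0, x, rfl, hx⟩ | ⟨h0, hz⟩
    · refine ⟨Or.inl ⟨h0, exists_app_opens hV hx⟩, ?_⟩
      have hR : (∃ x', i x = i x' ∧ ∃ V : X.opens.Pt, X.opens.Names u V.1 ∧ x' ∈ V.1) = (x ∈ V) :=
        propext ⟨fun ⟨x', hx', V', hV', hm⟩ => by
            rwa [hi hx', ← X.opens.unique hV' hV],
          fun hm => ⟨x, rfl, ⟨V, u, hV⟩, hV, hm⟩⟩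
      rw [hR]
      simpa [h0] using names_app_opens hV hx
    · refine ⟨Or.inr h0, ?_⟩
      have hR : ¬ ∃ x, z = i x ∧ ∃ V : X.opens.Pt, X.opens.Names u V.1 ∧ x ∈ V.1 :=
        fun ⟨x, hx, _⟩ => hz x hx
      simp only [sierpinski, hR, false_iff]
      simp [h0]
  obtain ⟨L, hL, hLn⟩ := hX.exists_point hK (rel := fun p x => Z.IsNbhdName p (i x)) <| by
    intro p x hp u V hu
    have hud : u ∈ X.opens.dom := ⟨_, hu⟩
    simp only [mem_ofPred_eq, fstName_pairName, sndName_pairName]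
    refine ⟨⟨⟨_, hp⟩, hud⟩, ?_⟩
    have hk := hKn p (i x) u hud hp
    have hR : (∃ x', i x = i x' ∧ ∃ V : X.opens.Pt, X.opens.Names u V.1 ∧ x' ∈ V.1) = (x ∈ V.1) :=
      propext ⟨fun ⟨x', hx', V', hV', hm⟩ => by
          rwa [hi hx', ← X.opens.unique hV' hu],
        fun hm => ⟨x, rfl, V, hu, hm⟩⟩
    rwa [hR] at hk
  exact ⟨L, hL, hLn⟩

/-- The inclusion of the left summand. -/
def coprodInl (X : RepSpace α) (Y : RepSpace β) (x : X.Pt) : (X.coprod Y).Pt :=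
  ⟨Sum.inl x.1, let ⟨p, hp⟩ := x.2; ⟨fun n => Nat.casesOn n 0 p, rfl, hp⟩⟩

/-- The inclusion of the right summand. -/
def coprodInr (X : RepSpace α) (Y : RepSpace β) (y : Y.Pt) : (X.coprod Y).Pt :=
  ⟨Sum.inr y.1, let ⟨p, hp⟩ := y.2; ⟨fun n => Nat.casesOn n 1 p, rfl, hp⟩⟩

theorem names_coprod_cases {X : RepSpace α} {Y : RepSpace β} {t : Baire} {z : (X.coprod Y).Pt}
    (ht : (X.coprod Y).Names t z.1) :
    (t 0 = 0 ∧ ∃ x, z = coprodInl X Y x ∧ X.Names (fun n => t (n + 1)) x.1) ∨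
    (t 0 = 1 ∧ ∃ y, z = coprodInr X Y y ∧ Y.Names (fun n => t (n + 1)) y.1) := by
  obtain ⟨x | y, hz⟩ := z
  · exact Or.inl ⟨ht.1, ⟨x, _, ht.2⟩, rfl, ht.2⟩
  · exact Or.inr ⟨ht.1, ⟨y, _, ht.2⟩, rfl, ht.2⟩

theorem coprodInl_ne_coprodInr {X : RepSpace α} {Y : RepSpace β} (x : X.Pt) (y : Y.Pt) :
    coprodInl X Y x ≠ coprodInr X Y y := fun h => by
  cases congrArg Subtype.val h

theorem coprodInl_injective (X : RepSpace α) (Y : RepSpace β) :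
    Function.Injective (coprodInl X Y) := fun _ _ h =>
  Subtype.ext (Sum.inl_injective (congrArg Subtype.val h))

theorem coprodInr_injective (X : RepSpace α) (Y : RepSpace β) :
    Function.Injective (coprodInr X Y) := fun _ _ h =>
  Subtype.ext (Sum.inr_injective (congrArg Subtype.val h))

/-- The summands are complementary open sets, so exactly one of the two observations `A` and `B`
succeeds. A parallel search tells which; the point is recovered in that summand and its tag is
prepended. -/
theorem IsKolmogorov.coprod {X : RepSpace α} {Y : RepSpace β} (hX : X.IsKolmogorov c)
    (hY : Y.IsKolmogorov c) : (X.coprod Y).IsKolmogorov c := by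
  set Z := X.coprod Y with hZ
  set D : Set Baire := {p | ∃ x, Z.IsNbhdName p (coprodInl X Y x)}
  set E : Set Baire := {p | ∃ y, Z.IsNbhdName p (coprodInr X Y y)}
  obtain ⟨K, hK, hKn⟩ := hX.exists_recover_summand Z (coprodInl X Y) (coprodInl_injective X Y) 0
    fun t z ht => (names_coprod_cases ht).imp id fun ⟨h1, y, hy, _⟩ =>
      ⟨by omega, fun x hx => coprodInl_ne_coprodInr x y (hx ▸ hy)⟩
  obtain ⟨L, hL, hLn⟩ := hY.exists_recover_summand Z (coprodInr X Y) (coprodInr_injective X Y) 1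
    fun t z ht => (names_coprod_cases ht).symm.imp id fun ⟨h1, x, hx, _⟩ =>
      ⟨by omega, fun y hy => coprodInl_ne_coprodInr x y (hx ▸ hy)⟩
  -- Tags are `0` or `1`, so `1 - t 0` is nonzero exactly on the left summand, and `t 0` exactly on
  -- the right one.
  obtain ⟨A, hA, hAn⟩ := exists_observe_set (c := c) Z (H := fun t _ => 1 - t 0)
    (S := range (coprodInl X Y))
    ((EffOn.id.reindex (Computable.const 0)).map
      (Primrec.nat_sub.comp (Primrec.const 1) Primrec.id).to_comp) <| by
    intro t z ht
    rcases names_coprod_cases ht with ⟨h0, x, rfl, _⟩ | ⟨h0, y, rfl, _⟩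
    · simp [sierpinski, h0]
    · simpa [sierpinski, h0] using fun x => coprodInl_ne_coprodInr x y
  obtain ⟨B, hB, hBn⟩ := exists_observe_set (c := c) Z (H := fun t _ => t 0)
    (S := range (coprodInr X Y)) (EffOn.id.reindex (Computable.const 0)) <| by
    intro t z ht
    rcases names_coprod_cases ht with ⟨h0, x, rfl, _⟩ | ⟨h0, y, rfl, _⟩
    · simpa [sierpinski, h0] using fun y => (coprodInl_ne_coprodInr x y).symm
    · simp [sierpinski, h0]
  have hDA : ∀ p ∈ D, (∃ n, A p n ≠ 0) ∧ ∀ n, B p n = 0 := by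
    rintro p ⟨x, hx⟩
    refine ⟨(hAn p _ hx).1 ⟨x, rfl⟩, fun n => not_not.1 fun hn => ?_⟩
    obtain ⟨y, hy⟩ := (hBn p _ hx).2 ⟨n, hn⟩
    exact coprodInl_ne_coprodInr x y hy.symm
  have hEB : ∀ p ∈ E, (∃ n, B p n ≠ 0) ∧ ∀ n, A p n = 0 := by
    rintro p ⟨y, hy⟩
    refine ⟨(hBn p _ hy).1 ⟨y, rfl⟩, fun n => not_not.1 fun hn => ?_⟩
    obtain ⟨x, hx⟩ := (hAn p _ hy).2 ⟨n, hn⟩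
    exact coprodInl_ne_coprodInr x y hx
  have hDE : {p | ∃ z, Z.IsNbhdName p z} = D ∪ E := by
    ext p
    refine ⟨fun ⟨z, hz⟩ => ?_, ?_⟩
    · obtain ⟨t, ht⟩ := z.2
      rcases names_coprod_cases ht with ⟨-, x, rfl, -⟩ | ⟨-, y, rfl, -⟩
      · exact Or.inl ⟨x, hz⟩
      · exact Or.inr ⟨y, hz⟩
    · rintro (⟨x, hx⟩ | ⟨y, hy⟩)
      exacts [⟨_, hx⟩, ⟨_, hy⟩]
  rw [hDE] at hA hB
  classical
  have hex : ∀ p ∈ D ∪ E, ∃ n, A p n + B p n ≠ 0 := by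
    rintro p (hp | hp)
    · obtain ⟨n, hn⟩ := (hDA p hp).1
      exact ⟨n, by omega⟩
    · obtain ⟨n, hn⟩ := (hEB p hp).1
      exact ⟨n, by omega⟩
  -- The first position at which either observation succeeds. The value of `B p` there is zero on
  -- `D` and nonzero on `E`, hence decides the case.
  let S : Baire → Baire := fun p _ => if h : ∃ n, A p n + B p n ≠ 0 then Nat.find h else 0
  have hadd : Computable fun m : ℕ => m.unpair.1 + m.unpair.2 :=
    (Primrec.nat_add.comp (Primrec.fst.comp Primrec.unpair)
      (Primrec.snd.comp Primrec.unpair)).to_comp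
  have hS : EffOn c S (D ∪ E) := by
    refine (((hA.zip hB).map hadd).reindex computable_unpair_snd).search S fun p hp n => ?_
    simp only [Nat.unpair_pair, S, dif_pos (hex p hp)]
    exact ⟨Nat.find_spec (hex p hp), fun j hj => not_not.1 (Nat.find_min (hex p hp) hj)⟩
  have hSne : ∀ p ∈ D ∪ E, A p (S p 0) + B p (S p 0) ≠ 0 := fun p hp => by
    simp only [S, dif_pos (hex p hp)]
    exact Nat.find_spec (hex p hp)
  have hcons : ∀ (τ : ℕ) {F : Baire → Baire} {D : Set Baire}, EffOn c F D →
      EffOn c (fun p n => (Nat.casesOn n τ (F p) : ℕ)) D := by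
    intro τ F D hF
    have he : Computable fun m : ℕ => if m.unpair.1 = 0 then τ else m.unpair.2 :=
      (Primrec.ite (Primrec.eq.comp (Primrec.fst.comp Primrec.unpair) (Primrec.const 0))
        (Primrec.const τ) (Primrec.snd.comp Primrec.unpair)).to_comp
    refine (((EffOn.const Computable.id).zip (hF.reindex Computable.pred)).map he).congr
      fun p _ => funext fun n => ?_
    cases n <;> simp
  have hT : EffOn c (fun p n => B p (S p n)) (D ∪ E) := hB.apply hS
  have hDT : ∀ p ∈ D, B p (S p 0) = 0 := fun p hp => (hDA p hp).2 _
  have hET : ∀ p ∈ E, B p (S p 0) ≠ 0 := fun p hp h0 =>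
    hSne p (Or.inr hp) (by rw [h0, (hEB p hp).2])
  have hfin := hT.cases (hcons 0 hK) (hcons 1 hL) hDT hET
  rw [← hDE] at hfin
  refine isKolmogorov_iff.2 ⟨_, hfin, fun p z hp => ?_⟩
  have hpDE : p ∈ D ∪ E := hDE ▸ ⟨z, hp⟩
  obtain ⟨t, ht⟩ := z.2
  rcases names_coprod_cases ht with ⟨-, x, rfl, -⟩ | ⟨-, y, rfl, -⟩
  · have h0 : (B p (S p 0) == 0) = true := by simpa using hDT p ⟨x, hp⟩
    rw [h0]
    exact ⟨rfl, hKn p x hp⟩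
  · have h0 : (B p (S p 0) == 0) = false := by simpa using hET p ⟨y, hp⟩
    rw [h0]
    exact ⟨rfl, hLn p y hp⟩

/-! ### Preservation of Kolmogorov spaces -/

theorem isKolmogorov_constructions (c : Prop) (X X' : RepSpace α) (Y : RepSpace β) :
    (X.IsKolmogorov c → Y.IsKolmogorov c → (X.prod Y).IsKolmogorov c) ∧
    (X.IsKolmogorov c → Y.IsKolmogorov c → (X.coprod Y).IsKolmogorov c) ∧
    (X.IsKolmogorov c → X'.IsKolmogorov c → (X.meet X').IsKolmogorov c) ∧
    (Y.IsKolmogorov c → Y.seqPow.IsKolmogorov c) ∧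
    (X.IsKolmogorov c → ∀ Z : Set α, Z ⊆ X.carrier → (X.subspace Z).IsKolmogorov c) ∧
    (Y.IsKolmogorov c → (X.fn Y).IsKolmogorov c) ∧
    X.opens.IsKolmogorov c ∧ X.closedPos.IsKolmogorov c ∧ X.closedNeg.IsKolmogorov c ∧
    X.closeds.IsKolmogorov c ∧ X.compactNeg.IsKolmogorov c ∧ X.compacts.IsKolmogorov c :=
  ⟨fun hX hY => hX.prod hY, fun hX hY => hX.coprod hY, fun hX hX' => hX.meet hX',
    fun hY => hY.seqPow, fun hX Z _ => hX.subspace Z, fun hY => hY.fn X,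
    isKolmogorov_opens c X, isKolmogorov_closedPos c X, isKolmogorov_closedNeg c X,
    (isKolmogorov_closedPos c X).meet (isKolmogorov_closedNeg c X), isKolmogorov_compactNeg c X,
    (isKolmogorov_closedPos c X).meet (isKolmogorov_compactNeg c X)⟩

end RepSpace

theorem corollary31 {α : Type u} {β : Type v} (X X' : RepSpace α) (Y : RepSpace β) :
    ((X.IsComputableKolmogorov → Y.IsComputableKolmogorov →
        (X.prod Y).IsComputableKolmogorov) ∧
      (X.IsComputableKolmogorov → Y.IsComputableKolmogorov →
        (X.coprod Y).IsComputableKolmogorov) ∧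
      (X.IsComputableKolmogorov → X'.IsComputableKolmogorov →
        (X.meet X').IsComputableKolmogorov) ∧
      (Y.IsComputableKolmogorov → Y.seqPow.IsComputableKolmogorov) ∧
      (X.IsComputableKolmogorov →
        ∀ Z : Set α, Z ⊆ X.carrier → (X.subspace Z).IsComputableKolmogorov) ∧
      (Y.IsComputableKolmogorov → (X.fn Y).IsComputableKolmogorov) ∧
      X.opens.IsComputableKolmogorov ∧
      X.closedPos.IsComputableKolmogorov ∧
      X.closedNeg.IsComputableKolmogorov ∧
      X.closeds.IsComputableKolmogorov ∧
      X.compactNeg.IsComputableKolmogorov ∧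
      X.compacts.IsComputableKolmogorov) ∧
    ((X.IsContinuousKolmogorov → Y.IsContinuousKolmogorov →
        (X.prod Y).IsContinuousKolmogorov) ∧
      (X.IsContinuousKolmogorov → Y.IsContinuousKolmogorov →
        (X.coprod Y).IsContinuousKolmogorov) ∧
      (X.IsContinuousKolmogorov → X'.IsContinuousKolmogorov →
        (X.meet X').IsContinuousKolmogorov) ∧
      (Y.IsContinuousKolmogorov → Y.seqPow.IsContinuousKolmogorov) ∧
      (X.IsContinuousKolmogorov →
        ∀ Z : Set α, Z ⊆ X.carrier → (X.subspace Z).IsContinuousKolmogorov) ∧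
      (Y.IsContinuousKolmogorov → (X.fn Y).IsContinuousKolmogorov) ∧
      X.opens.IsContinuousKolmogorov ∧
      X.closedPos.IsContinuousKolmogorov ∧
      X.closedNeg.IsContinuousKolmogorov ∧
      X.closeds.IsContinuousKolmogorov ∧
      X.compactNeg.IsContinuousKolmogorov ∧
      X.compacts.IsContinuousKolmogorov) := by
  have h := RepSpace.isKolmogorov_constructions True X X' Y
  have h' := RepSpace.isKolmogorov_constructions False X X' Y
  simp only [RepSpace.isKolmogorov_true_iff] at h
  simp only [RepSpace.isKolmogorov_false_iff] at h'
  exact ⟨h, h'⟩
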